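/- Let $\alpha=\alpha_0<\alpha_1<\dots<\alpha_m=\beta$ ($m\ge 1$) and let $A(x)=A_s$ for $\alpha_{s-1}<x\le\alpha_s$, where each $A_s$ is an invertible diagonalizable complex $n\times n$ matrix, $A_s=V_s\,\mathrm{diag}(a_{s,1},\dots,a_{s,n})V_s^{-1}$. Let $u,v\in\mathbb C^n$ be non-zero, and let $L$ be the operator $(Lf)(x)=A(x)f'(x)$ in $L^2((\alpha,\beta),\mathbb C^n)$ whose domain consists of all $f\in W^{1,2}((\alpha,\beta),\mathbb C^n)$ such that $f(\alpha)\in\mathbb C u$ and $\langle f(\beta),v\rangle=0$. Put $$F(z)=\langle U_mU_{m-1}\cdots U_1u,v\rangle,\qquad U_s=e^{z(\alpha_s-\alpha_{s-1})A_s^{-1}} .$$ For $t:\{1,\dots,m\}\to\{1,\dots,n\}$ let $\gamma_t$ be given by $\overline{\gamma_t}=\sum_{s=1}^m a_{s,t(s)}^{-1}(\alpha_s-\alpha_{s-1})$, and for a point $w$ let $$\delta_w=\sum_{t:\,\gamma_t=w}\langle V_mP_{t(m)}V_m^{-1}\cdots V_1P_{t(1)}V_1^{-1}u,v\rangle ,$$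 where $P_j$ is the diagonal matrix whose only non-zero entry is a $1$ in position $(j,j)$; thus $F(z)=\sum_w\delta_we^{z\overline w}$, the sum being over the distinct points $w$ among the $\gamma_t$. Let $K$ be the convex hull of all the $\gamma_t$. Assume that the data are generic in the following sense: $\delta_w\ne0$ for every vertex $w$ of $K$, and no $\gamma_t$ lies on an edge of $K$ unless it is a vertex of $K$. Let $K(x)$ be the convex hull of the eigenvalues of $A(x)^{-1}$ and let $b(x)$ be the length of the boundary of $K(x)$ (the sum of the lengths of the edges of this convex polygon; it is twice the length of $K(x)$ if $K(x)$ is a segment, and $0$ if $K(x)$ is a point). Let $N(E)$ be either the number of eigenvalues $z$ of $L$ such that $|z|\le E$, or the number of zeros $z$ of $F$, counted with multiplicity, such that $|z|\le E$. Then in both cases $N(E)$ is finite for every $E$, and $$N(E)=\frac{E}{2\pi}\int_\alpha^\beta b(x)\,dx+O(1)$$ as $E\to\infty$. -/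

import Mathlib

open Filter MeasureTheory Asymptotics
open scoped Matrix

namespace EllipticSystem

/-- The oriented edges of a convex polygon `K` in the plane: ordered pairs of distinct vertices
(extreme points) such that all of `K` lies on the left of the oriented line through them. They are
the pairs of consecutive vertices when the vertices are listed anticlockwise. A polygon that
degenerates to a segment with end points `p ≠ q` has the two vertices `p`, `q` and the two edges
`(p, q)`, `(q, p)`; a single point has no edge. -/
def edges (K : Set ℂ) : Set (ℂ × ℂ) :=
  {e | e.1 ∈ K.extremePoints ℝ ∧ e.2 ∈ K.extremePoints ℝ ∧ e.1 ≠ e.2 ∧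
    ∀ w ∈ K, 0 ≤ (starRingEnd ℂ (e.2 - e.1) * (w - e.1)).im}

/-- The length of the boundary of a convex polygon: the sum of the lengths of its edges. -/
noncomputable def perimeter (K : Set ℂ) : ℝ :=
  ∑ᶠ e ∈ edges K, dist e.1 e.2

/-- `b(x)`: the length of the boundary of the convex hull `K(x)` of the eigenvalues of
`A(x)⁻¹`. -/
noncomputable def b {n : ℕ} (A : ℝ → Matrix (Fin n) (Fin n) ℂ) (x : ℝ) : ℝ :=
  perimeter (convexHull ℝ (spectrum ℂ (A x)⁻¹))

/-- `f` is (the continuous representative of) an element of `W^{1,2}((α, β), ℂⁿ)` and `g` is its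
derivative: `g` is square integrable and `f` is the indefinite integral of `g`. -/
def HasW12Deriv {n : ℕ} (α β : ℝ) (f g : ℝ → Fin n → ℂ) : Prop :=
  MemLp g 2 (volume.restrict (Set.Ioo α β)) ∧
    ∀ x ∈ Set.Icc α β, f x = f α + ∫ t in α..x, g t

/-- `z` is an eigenvalue of the operator `L f = A f'` in `L²((α, β), ℂⁿ)` whose domain consists of
the `f` in `W^{1,2}` such that `f(α)` is a multiple of `u` and `⟨f(β), v⟩ = 0`. -/
def IsEigenvalue {n : ℕ} (α β : ℝ) (A : ℝ → Matrix (Fin n) (Fin n) ℂ) (u v : Fin n → ℂ)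
    (z : ℂ) : Prop :=
  ∃ f g : ℝ → Fin n → ℂ, HasW12Deriv α β f g ∧
    f α ∈ Submodule.span ℂ {u} ∧ f β ⬝ᵥ star v = 0 ∧
    (∃ x ∈ Set.Icc α β, f x ≠ 0) ∧
    ∀ᵐ x ∂(volume.restrict (Set.Ioo α β)), A x *ᵥ g x = z • f x

/-- The ordered product `M_m M_{m-1} ⋯ M_2 M_1`. -/
def descProd {n m : ℕ} (M : Fin m → Matrix (Fin n) (Fin n) ℂ) : Matrix (Fin n) (Fin n) ℂ :=
  (List.ofFn M).reverse.prod

/-- The length of the `s`-th interval of a partition. -/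
def len {m : ℕ} (p : Fin (m + 1) → ℝ) (s : Fin m) : ℝ := p s.succ - p s.castSucc

/-- `U(z, β) = U_m ⋯ U_1` with `U_s = exp (z (α_s - α_{s-1}) A_s⁻¹)`: the matrix which maps
`f(α)` to `f(β)` for the solutions `f` of `A f' = z f`. -/
noncomputable def transfer {n m : ℕ} (p : Fin (m + 1) → ℝ) (M : Fin m → Matrix (Fin n) (Fin n) ℂ)
    (z : ℂ) : Matrix (Fin n) (Fin n) ℂ :=
  descProd fun s => NormedSpace.exp ((z * (len p s : ℂ)) • (M s)⁻¹)

/-- The characteristic function `F(z) = ⟨U(z, β) u, v⟩`. -/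
noncomputable def charFun {n m : ℕ} (p : Fin (m + 1) → ℝ) (M : Fin m → Matrix (Fin n) (Fin n) ℂ)
    (u v : Fin n → ℂ) (z : ℂ) : ℂ :=
  (transfer p M z *ᵥ u) ⬝ᵥ star v

/-- The number of zeros of `F` in the closed disc of radius `E`, counted with multiplicity. -/
noncomputable def zeroCount (F : ℂ → ℂ) (E : ℝ) : ℕ :=
  ∑ᶠ z ∈ {z : ℂ | ‖z‖ ≤ E ∧ F z = 0}, analyticOrderNatAt F z

/-- The point `γ` attached to a choice `t` of one eigenvalue `a_{s,t(s)}` of each `A_s`; its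
complex conjugate is `∑ s, a_{s,t(s)}⁻¹ (α_s - α_{s-1})`. -/
noncomputable def gam {n m : ℕ} (p : Fin (m + 1) → ℝ) (a : Fin m → Fin n → ℂ)
    (t : Fin m → Fin n) : ℂ :=
  starRingEnd ℂ (∑ s, (a s (t s))⁻¹ * (len p s : ℂ))

/-- The coefficient of `exp (z * conj w)` when
`F(z) = ⟨V_m exp(z D_m) V_m⁻¹ ⋯ V_1 exp(z D_1) V_1⁻¹ u, v⟩` is multiplied out and equal
exponents are collected. -/
noncomputable def delta {n m : ℕ} (p : Fin (m + 1) → ℝ) (a : Fin m → Fin n → ℂ)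
    (V : Fin m → Matrix (Fin n) (Fin n) ℂ) (u v : Fin n → ℂ) (w : ℂ) : ℂ :=
  ∑ t : Fin m → Fin n with gam p a t = w,
    (descProd (fun s => V s * Matrix.single (t s) (t s) 1 * (V s)⁻¹) *ᵥ u) ⬝ᵥ star v

/-- The genericity assumption, for the convex hull `K` of all points `γ`: the coefficient of every
vertex of `K` is non-zero, and no `γ` lies within an edge of `K`. -/
def Generic {n m : ℕ} (p : Fin (m + 1) → ℝ) (a : Fin m → Fin n → ℂ)
    (V : Fin m → Matrix (Fin n) (Fin n) ℂ) (u v : Fin n → ℂ) : Prop :=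
  (∀ w ∈ (convexHull ℝ (Set.range (gam p a))).extremePoints ℝ, delta p a V u v w ≠ 0) ∧
    ∀ e ∈ edges (convexHull ℝ (Set.range (gam p a))), ∀ t, gam p a t ∉ openSegment ℝ e.1 e.2

end EllipticSystem

/-! Write `z = rν` with `|ν| = 1`. The term `δ_w exp(z conj w)` of `F` has modulus `|δ_w| exp(r
Re(conj ν · w))`, so for large `r` only the points `w` lying farthest in the direction `ν` matter.
If they reduce to one vertex of `K`, its term dominates and `F` cannot vanish. Hence zeros of large
modulus occur only near the directions of the outer normals of the edges of `K`
(`GenericSum.exists_edge_of_zero`).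

Near the normal of an edge `(e₁, e₂)`, genericity leaves exactly two leading terms. With `d = e₂ -
e₁` and `ζ = z conj d`, `F` is a non-vanishing factor times `1 + c exp ζ + h(ζ)`, where `h` and `h'`
are small in a half-strip `|Re ζ| ≤ B`, `Im ζ ≤ -Y`. There the zeros are simple and are
perturbations of points spaced by `2πi` (`exists_bound_ncard_stripZeros`), so the edge contributes
`E|d|/2π + O(1)` zeros. The half-strips of different edges are disjoint for large `Y`, and only
finitely many zeros lie outside them. Adding up gives `E/2π` times the perimeter of `K`
(`GenericSum.ncard_zeros`). All but finitely many zeros being simple, multiplicities change the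
count by a bounded amount.

Two identifications remain. Solving `A f' = z f` interval by interval shows that the eigenvalues are
the zeros of `F` (`isEigenvalue_iff`). And the conjugates of the `γ_t` form the Minkowski sum of the
spectra of the `A_s⁻¹` scaled by the interval lengths. In each direction the face of a sum is the
sum of the faces, so the perimeter is additive (`perimeter_sum`), and the perimeter of `K` is `∫ b`
(`integral_b`). -/

namespace EllipticSystem

/-! ### Faces, edges and perimeter of plane polygons -/

open scoped ComplexConjugate

/-- The points of `S` that lie farthest in the direction `ν`. -/
def face (S : Set ℂ) (ν : ℂ) : Set ℂ :=
  {w | w ∈ S ∧ ∀ w' ∈ S, (conj ν * w').re ≤ (conj ν * w).re}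

/-- `e` consists of the two end points of the face of `S` in the direction `ν`, in anticlockwise
order. -/
def IsSide (S : Set ℂ) (ν : ℂ) (e : ℂ × ℂ) : Prop :=
  e.1 ∈ face S ν ∧ e.2 ∈ face S ν ∧
    ∀ w ∈ face S ν, (conj ν * e.1).im ≤ (conj ν * w).im ∧ (conj ν * w).im ≤ (conj ν * e.2).im

lemma face_re_eq {S : Set ℂ} {ν w w' : ℂ} (hw : w ∈ face S ν) (hw' : w' ∈ face S ν) :
    (conj ν * w).re = (conj ν * w').re :=
  le_antisymm (hw'.2 _ hw.1) (hw.2 _ hw'.1)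

lemma conj_mul_cancel {ν w w' : ℂ} (hν : ‖ν‖ = 1) (hre : (conj ν * w).re = (conj ν * w').re)
    (him : (conj ν * w).im = (conj ν * w').im) : w = w' := by
  have h : conj ν * w = conj ν * w' := Complex.ext hre him
  have h0 : conj ν ≠ 0 := by
    intro h0
    rw [← Complex.norm_conj, h0] at hν
    simp at hν
  exact mul_left_cancel₀ h0 h

lemma mul_conj_of_norm_one {ν : ℂ} (hν : ‖ν‖ = 1) : ν * conj ν = 1 := by
  rw [Complex.mul_conj, Complex.normSq_eq_norm_sq, hν]; simp

lemma IsSide.unique {S : Set ℂ} {ν : ℂ} {e e' : ℂ × ℂ} (hν : ‖ν‖ = 1) (h : IsSide S ν e)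
    (h' : IsSide S ν e') : e = e' := by
  refine Prod.ext ?_ ?_
  · exact conj_mul_cancel hν (face_re_eq h.1 h'.1)
      (le_antisymm (h.2.2 _ h'.1).1 (h'.2.2 _ h.1).1)
  · exact conj_mul_cancel hν (face_re_eq h.2.1 h'.2.1)
      (le_antisymm (h'.2.2 _ h.2.1).2 (h.2.2 _ h'.2.1).2)

lemma exists_isSide {S : Set ℂ} (hS : S.Finite) (hne : S.Nonempty) (ν : ℂ) :
    ∃ e, IsSide S ν e := by
  obtain ⟨w, hw, hmax⟩ := Set.exists_max_image S (fun w => (conj ν * w).re) hS hne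
  have hf : (face S ν).Finite := hS.subset fun _ h => h.1
  have hfn : (face S ν).Nonempty := ⟨w, hw, hmax⟩
  obtain ⟨w1, h1, h1'⟩ := Set.exists_min_image _ (fun w => (conj ν * w).im) hf hfn
  obtain ⟨w2, h2, h2'⟩ := Set.exists_max_image _ (fun w => (conj ν * w).im) hf hfn
  exact ⟨(w1, w2), h1, h2, fun w hw => ⟨h1' w hw, h2' w hw⟩⟩

/-- The end points agree in the coordinate along `ν`, so the side is a non-negative multiple of `I *
ν`, the outer normal turned anticlockwise by a right angle. -/
lemma IsSide.sub_eq {S : Set ℂ} {ν : ℂ} {e : ℂ × ℂ} (hν : ‖ν‖ = 1) (h : IsSide S ν e) :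
    e.2 - e.1 = dist e.1 e.2 * Complex.I * ν := by
  have hre := face_re_eq h.1 h.2.1
  have him := (h.2.2 _ h.1).2
  set x : ℝ := (conj ν * e.2).im - (conj ν * e.1).im with hx
  have h1 : conj ν * (e.2 - e.1) = x * Complex.I := by
    apply Complex.ext
    · rw [mul_sub, Complex.sub_re]; simp [hre]
    · rw [mul_sub, Complex.sub_im]; simp [hx]
  have h2 : e.2 - e.1 = x * Complex.I * ν := by
    calc e.2 - e.1 = (ν * conj ν) * (e.2 - e.1) := by rw [mul_conj_of_norm_one hν, one_mul]
      _ = ν * (conj ν * (e.2 - e.1)) := by ring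
      _ = _ := by rw [h1]; ring
  have h3 : dist e.1 e.2 = x := by
    rw [dist_comm, dist_eq_norm, h2]
    rw [norm_mul, norm_mul, hν, Complex.norm_I, Complex.norm_real, Real.norm_eq_abs,
      abs_of_nonneg (sub_nonneg.2 him), mul_one, mul_one]
  rw [h3, h2]

/-- An open half-plane together with a ray of its boundary line. With the lexicographically largest
point of `S` as the end of the ray it contains `S`, which makes that point extreme. -/
lemma convex_lexHalfPlane (ν : ℂ) (M I : ℝ) :
    Convex ℝ {w : ℂ | (conj ν * w).re ≤ M ∧ ((conj ν * w).re = M → (conj ν * w).im ≤ I)} := by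
  intro x hx y hy a b ha hb hab
  have hre : (conj ν * (a • x + b • y)).re = a * (conj ν * x).re + b * (conj ν * y).re := by
    simp; ring
  have him : (conj ν * (a • x + b • y)).im = a * (conj ν * x).im + b * (conj ν * y).im := by
    simp; ring
  simp only [Set.mem_ofPred_eq, hre, him] at *
  obtain ⟨hx1, hx2⟩ := hx
  obtain ⟨hy1, hy2⟩ := hy
  have hM : M = a * M + b * M := by rw [← add_mul, hab, one_mul]
  refine ⟨by nlinarith, fun h => ?_⟩
  -- Zero weights are split off: only when both weights are positive does reaching `M` force both
  -- points onto the boundary line.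
  rcases ha.eq_or_lt with rfl | ha
  · have : b = 1 := by linarith
    subst this
    rw [zero_mul, one_mul, zero_add] at h ⊢
    exact hy2 h
  rcases hb.eq_or_lt with rfl | hb
  · have : a = 1 := by linarith
    subst this
    rw [zero_mul, one_mul, add_zero] at h ⊢
    exact hx2 h
  have h1 : (conj ν * x).re = M := by nlinarith
  have h2 : (conj ν * y).re = M := by nlinarith
  have hI : I = a * I + b * I := by rw [← add_mul, hab, one_mul]
  nlinarith [hx2 h1, hy2 h2]

lemma mem_extremePoints_of_lex {S : Set ℂ} {ν w : ℂ} (hν : ‖ν‖ = 1) (hw : w ∈ face S ν)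
    (him : ∀ w' ∈ face S ν, (conj ν * w').im ≤ (conj ν * w).im) :
    w ∈ (convexHull ℝ S).extremePoints ℝ := by
  set C := {w' : ℂ | (conj ν * w').re ≤ (conj ν * w).re ∧
    ((conj ν * w').re = (conj ν * w).re → (conj ν * w').im ≤ (conj ν * w).im)} with hC
  have hsub : convexHull ℝ S ⊆ C := by
    refine convexHull_min (fun w' hw' => ⟨hw.2 _ hw', fun h => him _ ⟨hw', fun w'' hw'' => ?_⟩⟩)
      (convex_lexHalfPlane _ _ _)
    rw [h]; exact hw.2 _ hw''
  rw [mem_extremePoints]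
  refine ⟨subset_convexHull ℝ S hw.1, fun x hx y hy hxy => ?_⟩
  obtain ⟨hx1, hx2⟩ := hsub hx
  obtain ⟨hy1, hy2⟩ := hsub hy
  obtain ⟨a, b, ha, hb, hab, h⟩ := hxy
  have hre : (conj ν * w).re = a * (conj ν * x).re + b * (conj ν * y).re := by
    rw [← h]; simp; ring
  have hi : (conj ν * w).im = a * (conj ν * x).im + b * (conj ν * y).im := by
    rw [← h]; simp; ring
  have hM : (conj ν * w).re = a * (conj ν * w).re + b * (conj ν * w).re := by
    rw [← add_mul, hab, one_mul]
  have hI : (conj ν * w).im = a * (conj ν * w).im + b * (conj ν * w).im := by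
    rw [← add_mul, hab, one_mul]
  have h1 : (conj ν * x).re = (conj ν * w).re := by nlinarith
  have h2 : (conj ν * y).re = (conj ν * w).re := by nlinarith
  have h3 := hx2 h1
  have h4 := hy2 h2
  exact ⟨conj_mul_cancel hν h1 (by nlinarith), conj_mul_cancel hν h2 (by nlinarith)⟩

lemma conj_mul_conj_re (ν w : ℂ) : (conj (conj ν) * conj w).re = (conj ν * w).re := by
  simp

lemma conj_mul_conj_im (ν w : ℂ) : (conj (conj ν) * conj w).im = -(conj ν * w).im := by
  simp; ring

lemma face_image_conj (S : Set ℂ) (ν : ℂ) : face (conj '' S) (conj ν) = conj '' face S ν := by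
  ext w
  constructor
  · rintro ⟨⟨w, hw, rfl⟩, h⟩
    refine ⟨w, ⟨hw, fun w' hw' => ?_⟩, rfl⟩
    have := h _ ⟨w', hw', rfl⟩
    rwa [conj_mul_conj_re, conj_mul_conj_re] at this
  · rintro ⟨w, ⟨hw, h⟩, rfl⟩
    refine ⟨⟨w, hw, rfl⟩, ?_⟩
    rintro _ ⟨w', hw', rfl⟩
    rw [conj_mul_conj_re, conj_mul_conj_re]
    exact h _ hw'

/-- Conjugation keeps the coordinate along the normal and reverses the one along the face, which
reduces the other end of the face to `mem_extremePoints_of_lex`. -/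
lemma mem_extremePoints_of_lex' {S : Set ℂ} {ν w : ℂ} (hν : ‖ν‖ = 1) (hw : w ∈ face S ν)
    (him : ∀ w' ∈ face S ν, (conj ν * w).im ≤ (conj ν * w').im) :
    w ∈ (convexHull ℝ S).extremePoints ℝ := by
  set L : ℂ ≃ₗ[ℝ] ℂ := Complex.conjAe.toLinearEquiv with hL
  have hLc : ∀ T : Set ℂ, L '' T = conj '' T := fun T => rfl
  have h1 : conj w ∈ (convexHull ℝ (conj '' S)).extremePoints ℝ := by
    refine mem_extremePoints_of_lex (ν := conj ν) (by simpa using hν) ?_ ?_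
    · rw [face_image_conj]; exact ⟨w, hw, rfl⟩
    · rw [face_image_conj]
      rintro _ ⟨w', hw', rfl⟩
      rw [conj_mul_conj_im, conj_mul_conj_im]
      exact neg_le_neg (him _ hw')
  have h2 : convexHull ℝ (conj '' S) = L '' convexHull ℝ S := by
    rw [← hLc]; exact (L.toLinearMap.image_convexHull S).symm
  rw [h2, ← image_extremePoints] at h1
  obtain ⟨w', hw', h⟩ := h1
  have : w' = w := (starRingEnd ℂ).injective h
  rwa [← this]

lemma IsSide.fst_mem {S : Set ℂ} {ν : ℂ} {e : ℂ × ℂ} (hν : ‖ν‖ = 1) (h : IsSide S ν e) :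
    e.1 ∈ (convexHull ℝ S).extremePoints ℝ :=
  mem_extremePoints_of_lex' hν h.1 fun w hw => (h.2.2 w hw).1

lemma IsSide.snd_mem {S : Set ℂ} {ν : ℂ} {e : ℂ × ℂ} (hν : ‖ν‖ = 1) (h : IsSide S ν e) :
    e.2 ∈ (convexHull ℝ S).extremePoints ℝ :=
  mem_extremePoints_of_lex hν h.2.1 fun w hw => (h.2.2 w hw).2

lemma convexHull_im_nonneg {S : Set ℂ} {q c : ℂ} (h : ∀ w ∈ S, 0 ≤ (q * (w - c)).im) {w : ℂ}
    (hw : w ∈ convexHull ℝ S) : 0 ≤ (q * (w - c)).im := by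
  have : Convex ℝ {w : ℂ | 0 ≤ (q * (w - c)).im} := by
    intro x hx y hy a b ha hb hab
    simp only [Set.mem_ofPred_eq] at *
    have hbb : b = 1 - a := by linarith
    have : (q * (a • x + b • y - c)).im = a * (q * (x - c)).im + b * (q * (y - c)).im := by
      subst hbb; simp; ring
    rw [this]; positivity
  exact convexHull_min h this hw

lemma IsSide.conj_sub_mul_im {S : Set ℂ} {ν : ℂ} {e : ℂ × ℂ} (hν : ‖ν‖ = 1) (h : IsSide S ν e)
    (w : ℂ) : (conj (e.2 - e.1) * (w - e.1)).im =
      dist e.1 e.2 * ((conj ν * e.1).re - (conj ν * w).re) := by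
  rw [h.sub_eq hν]; simp; ring

lemma IsSide.mem_edges {S : Set ℂ} {ν : ℂ} {e : ℂ × ℂ} (hν : ‖ν‖ = 1) (h : IsSide S ν e)
    (hne : e.1 ≠ e.2) : e ∈ edges (convexHull ℝ S) := by
  refine ⟨h.fst_mem hν, h.snd_mem hν, hne, fun w hw => convexHull_im_nonneg (fun w hw => ?_) hw⟩
  rw [h.conj_sub_mul_im hν]
  exact mul_nonneg dist_nonneg (sub_nonneg.2 (h.1.2 _ hw))

/-- The normal is the edge turned clockwise by a right angle; that `K` lies on the left says that
the edge lies in the face. A face point `e.1 + t d` with `t < 0` or `t > 1` would put `e.1` or `e.2`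
inside an open segment, against extremality. -/
lemma exists_isSide_of_mem_edges {S : Set ℂ} {e : ℂ × ℂ} (he : e ∈ edges (convexHull ℝ S)) :
    ∃ ν : ℂ, ‖ν‖ = 1 ∧ IsSide S ν e := by
  obtain ⟨h1, h2, hne, hleft⟩ := he
  set d := e.2 - e.1 with hd
  have hd0 : d ≠ 0 := sub_ne_zero.2 hne.symm
  have hdn : 0 < ‖d‖ := norm_pos_iff.2 hd0
  have hdC : (‖d‖ : ℂ) ≠ 0 := by exact_mod_cast hdn.ne'
  set ν : ℂ := -Complex.I * d / ‖d‖ with hνd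
  have hν : ‖ν‖ = 1 := by
    rw [hνd]; simp [hd0]
  have hconj : ∀ w, conj ν * w = Complex.I * (conj d * w) / ‖d‖ := by
    intro w; rw [hνd]; simp; ring
  have hre : ∀ w, (conj ν * w).re = -(conj d * w).im / ‖d‖ := by
    intro w; rw [hconj, Complex.div_ofReal_re]; simp [-Complex.mul_re, -Complex.mul_im, Complex.I_mul_re]
  have him : ∀ w, (conj ν * w).im = (conj d * w).re / ‖d‖ := by
    intro w; rw [hconj, Complex.div_ofReal_im]; simp [-Complex.mul_re, -Complex.mul_im, Complex.I_mul_im]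
  have hS1 := extremePoints_convexHull_subset h1
  have hS2 := extremePoints_convexHull_subset h2
  have hle : ∀ w ∈ S, (conj ν * w).re ≤ (conj ν * e.1).re := by
    intro w hw
    have := hleft w (subset_convexHull ℝ S hw)
    rw [hre, hre]
    rw [mul_sub, Complex.sub_im] at this
    gcongr
    linarith
  have he2 : e.2 = e.1 + d := by simp [hd]
  have hdd : conj d * d = ((‖d‖ ^ 2 : ℝ) : ℂ) := by
    rw [mul_comm, Complex.mul_conj, Complex.normSq_eq_norm_sq]
  have heq : (conj ν * e.2).re = (conj ν * e.1).re := by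
    rw [hre, hre, he2, mul_add, hdd, Complex.add_im, Complex.ofReal_im, add_zero]
  -- every point of the face is of the form `e.1 + t d`
  have hline : ∀ w ∈ face S ν, ∃ t : ℝ, w = e.1 + t * d ∧ (conj d * w).re = (conj d * e.1).re + t * ‖d‖ ^ 2 := by
    intro w hw
    have h0 : (conj ν * (w - e.1)).re = 0 := by
      rw [mul_sub, Complex.sub_re, sub_eq_zero]
      exact le_antisymm (hle w hw.1) (hw.2 _ hS1)
    have h00 : (conj d * (w - e.1)).im = 0 := by
      rw [hre] at h0
      have := (div_eq_zero_iff.1 h0).resolve_right hdn.ne'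
      linarith
    refine ⟨(conj d * (w - e.1)).re / ‖d‖ ^ 2, ?_, ?_⟩
    · have : conj d * (w - e.1) = ((conj d * (w - e.1)).re : ℂ) :=
        Complex.ext rfl (by rw [h00]; simp)
      have h3 : ((‖d‖ : ℂ)) ^ 2 * (w - e.1) = (conj d * (w - e.1)).re * d := by
        rw [← this]
        have : (‖d‖ : ℂ) ^ 2 = conj d * d := by rw [hdd]; push_cast; rfl
        rw [this]; ring
      push_cast
      rw [← sub_eq_iff_eq_add']
      rw [div_mul_eq_mul_div, ← h3]
      field_simp
    · rw [div_mul_cancel₀ _ (by positivity), mul_sub, Complex.sub_re]; ring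
  refine ⟨ν, hν, ⟨hS1, hle⟩, ⟨hS2, by simpa only [heq] using hle⟩, fun w hw => ?_⟩
  obtain ⟨t, hwt, hret⟩ := hline w hw
  have he2re : (conj d * e.2).re = (conj d * e.1).re + ‖d‖ ^ 2 := by
    rw [he2, mul_add, hdd, Complex.add_re, Complex.ofReal_re]
  rw [him, him, him]
  have hwK := subset_convexHull ℝ S hw.1
  rw [mem_extremePoints] at h1 h2
  constructor
  · refine div_le_div_of_nonneg_right ?_ hdn.le
    rw [hret]
    by_contra! hlt
    have ht : t < 0 := by nlinarith [sq_nonneg ‖d‖]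
    have : e.1 ∈ openSegment ℝ w e.2 := by
      refine ⟨1 / (1 - t), -t / (1 - t), by apply div_pos <;> linarith,
        by apply div_pos <;> linarith, by field_simp [(by linarith : (1 - t) ≠ 0)]; ring, ?_⟩
      have h1t : (1 - t : ℂ) ≠ 0 := by
        have : (1 - t) ≠ 0 := by linarith
        exact_mod_cast this
      rw [hwt, he2]
      simp only [Complex.real_smul]
      push_cast
      field_simp
      ring
    exact hne ((h1.2 w hwK e.2 h2.1 this).2).symm
  · refine div_le_div_of_nonneg_right ?_ hdn.le
    rw [hret, he2re]
    by_contra! hlt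
    have ht : 1 < t := by nlinarith [sq_nonneg ‖d‖]
    have : e.2 ∈ openSegment ℝ e.1 w := by
      refine ⟨(t - 1) / t, 1 / t, by apply div_pos <;> linarith,
        by apply div_pos <;> linarith, by field_simp [(by linarith : t ≠ 0)]; ring, ?_⟩
      have h1t : (t : ℂ) ≠ 0 := by
        have : t ≠ 0 := by linarith
        exact_mod_cast this
      rw [hwt, he2]
      simp only [Complex.real_smul]
      push_cast
      field_simp
      ring
    exact hne (h2.2 e.1 h1.1 w hwK this).1

lemma finite_edges {S : Set ℂ} (hS : S.Finite) : (edges (convexHull ℝ S)).Finite :=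
  (hS.prod hS).subset fun _ he =>
    ⟨extremePoints_convexHull_subset he.1, extremePoints_convexHull_subset he.2.1⟩

lemma IsSide.dist_eq_sub {S : Set ℂ} {ν : ℂ} {e : ℂ × ℂ} (hν : ‖ν‖ = 1) (h : IsSide S ν e) :
    dist e.1 e.2 = (conj ν * e.2).im - (conj ν * e.1).im := by
  have h1 : conj ν * (e.2 - e.1) = dist e.1 e.2 * Complex.I := by
    rw [h.sub_eq hν]
    linear_combination (dist e.1 e.2 * Complex.I) * mul_conj_of_norm_one hν
  rw [← Complex.sub_im, ← mul_sub, h1]; simp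

lemma IsSide.diam_face {S : Set ℂ} {ν : ℂ} {e : ℂ × ℂ} (hν : ‖ν‖ = 1) (h : IsSide S ν e) :
    Metric.diam (face S ν) = dist e.1 e.2 := by
  have hb : ∀ x ∈ face S ν, ∀ y ∈ face S ν, dist x y ≤ dist e.1 e.2 := by
    intro x hx y hy
    have h1 : dist x y = |(conj ν * x).im - (conj ν * y).im| := by
      have : conj ν * (x - y) = (((conj ν * x).im - (conj ν * y).im : ℝ) : ℂ) * Complex.I := by
        apply Complex.ext
        · rw [mul_sub, Complex.sub_re, face_re_eq hx hy]; simp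
        · rw [mul_sub, Complex.sub_im]; simp
      have h2 := congrArg norm this
      rw [norm_mul, Complex.norm_conj, hν, one_mul] at h2
      rw [dist_eq_norm, h2, norm_mul, Complex.norm_I, Complex.norm_real, Real.norm_eq_abs, mul_one]
    rw [h1, h.dist_eq_sub hν, abs_le]
    have := h.2.2 x hx
    have := h.2.2 y hy
    constructor <;> linarith
  refine le_antisymm (Metric.diam_le_of_forall_dist_le dist_nonneg hb) ?_
  exact Metric.dist_le_diam_of_mem (Metric.isBounded_iff.2 ⟨_, fun x hx y hy => hb x hx y hy⟩) h.1 h.2.1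

/-- Directions whose face has positive diameter correspond bijectively to edges. Summing over
directions gives different polygons a common index set. A segment is met twice, for `ν` and for
`-ν`. -/
lemma perimeter_eq_finsum_diam_face {S : Set ℂ} (hS : S.Finite) (hne : S.Nonempty) :
    perimeter (convexHull ℝ S) = ∑ᶠ ν ∈ Metric.sphere (0 : ℂ) 1, Metric.diam (face S ν) ∧
    (Metric.sphere (0 : ℂ) 1 ∩ Function.support fun ν => Metric.diam (face S ν)).Finite := by
  choose σ hσ using exists_isSide hS hne
  have hbij : Set.BijOn σ
      (Metric.sphere (0 : ℂ) 1 ∩ Function.support fun ν => Metric.diam (face S ν))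
      (edges (convexHull ℝ S)) := by
    refine ⟨?_, ?_, ?_⟩
    · rintro ν ⟨hν, hd⟩
      have hν : ‖ν‖ = 1 := by simpa using hν
      refine (hσ ν).mem_edges hν fun h => hd ?_
      change Metric.diam (face S ν) = 0
      rw [(hσ ν).diam_face hν, h, dist_self]
    · rintro ν ⟨hν, hd⟩ ν' ⟨hν', hd'⟩ h
      have hν : ‖ν‖ = 1 := by simpa using hν
      have hν' : ‖ν'‖ = 1 := by simpa using hν'
      have h1 := (hσ ν).sub_eq hν
      have h2 := (hσ ν').sub_eq hν'
      rw [← h, h1] at h2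
      have hd : dist (σ ν).1 (σ ν).2 ≠ 0 := by rwa [← (hσ ν).diam_face hν]
      have : (dist (σ ν).1 (σ ν).2 * Complex.I : ℂ) ≠ 0 := by
        refine mul_ne_zero ?_ Complex.I_ne_zero
        exact_mod_cast hd
      exact mul_left_cancel₀ this h2
    · intro e he
      obtain ⟨ν, hν, hs⟩ := exists_isSide_of_mem_edges he
      refine ⟨ν, ⟨by simpa using hν, ?_⟩, (hσ ν).unique hν hs⟩
      rw [Function.mem_support, hs.diam_face hν]
      exact dist_ne_zero.2 he.2.2.1
  refine ⟨?_, hbij.finite_iff_finite.2 (finite_edges hS)⟩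
  rw [perimeter, ← finsum_mem_inter_support (fun ν => Metric.diam (face S ν))]
  refine (finsum_mem_eq_of_bijOn σ hbij fun ν hν => ?_).symm
  exact (hσ ν).diam_face (by simpa using hν.1)

lemma perimeter_image_conj {S : Set ℂ} (hS : S.Finite) (hne : S.Nonempty) :
    perimeter (convexHull ℝ (conj '' S)) = perimeter (convexHull ℝ S) := by
  rw [(perimeter_eq_finsum_diam_face hS hne).1,
    (perimeter_eq_finsum_diam_face (hS.image _) (hne.image _)).1]
  refine (finsum_mem_eq_of_bijOn (fun ν => conj ν) ⟨?_, ?_, ?_⟩ fun ν hν => ?_).symm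
  · intro ν hν; simpa using hν
  · exact (starRingEnd ℂ).injective.injOn
  · intro ν hν; exact ⟨conj ν, by simpa using hν, by simp⟩
  · rw [face_image_conj]
    exact (Complex.isometry_conj.diam_image _).symm

/-! ### Minkowski sums -/

section Sum

variable {m n : ℕ} {c : Fin m → ℝ} {f : Fin m → Fin n → ℂ} {ν : ℂ}

lemma conj_mul_sum_re (x : Fin m → ℂ) :
    (conj ν * ∑ s, x s * (c s : ℂ)).re = ∑ s, c s * (conj ν * x s).re := by
  rw [Finset.mul_sum, Complex.re_sum]
  exact Finset.sum_congr rfl fun s _ => by simp; ring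

lemma conj_mul_sum_im (x : Fin m → ℂ) :
    (conj ν * ∑ s, x s * (c s : ℂ)).im = ∑ s, c s * (conj ν * x s).im := by
  rw [Finset.mul_sum, Complex.im_sum]
  exact Finset.sum_congr rfl fun s _ => by simp; ring

/-- The summands vary independently and the weights are positive, so the sum is maximal in direction
`ν` exactly when every summand is; changing one coordinate of `t` shows the forward direction. -/
lemma mem_face_sum_iff (hc : ∀ s, 0 < c s) (t : Fin m → Fin n) :
    (∑ s, f s (t s) * (c s : ℂ)) ∈ face (Set.range fun t : Fin m → Fin n =>
      ∑ s, f s (t s) * (c s : ℂ)) ν ↔ ∀ s, f s (t s) ∈ face (Set.range (f s)) ν := by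
  constructor
  · rintro ⟨-, h⟩ s
    refine ⟨⟨_, rfl⟩, ?_⟩
    rintro _ ⟨j, rfl⟩
    have := h _ ⟨Function.update t s j, rfl⟩
    rw [conj_mul_sum_re (fun s => f s (t s)),
      conj_mul_sum_re (fun r => f r (Function.update t s j r)),
      ← Finset.add_sum_erase _ _ (Finset.mem_univ s),
      ← Finset.add_sum_erase (a := s) _ _ (Finset.mem_univ s)] at this
    have heq : ∑ r ∈ Finset.univ.erase s, c r * (conj ν * f r (Function.update t s j r)).re =
        ∑ r ∈ Finset.univ.erase s, c r * (conj ν * f r (t r)).re :=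
      Finset.sum_congr rfl fun r hr => by rw [Function.update_of_ne (Finset.ne_of_mem_erase hr)]
    rw [heq, Function.update_self] at this
    exact le_of_mul_le_mul_left (by linarith) (hc s)
  · intro h
    refine ⟨⟨t, rfl⟩, ?_⟩
    rintro _ ⟨t', rfl⟩
    rw [conj_mul_sum_re (fun s => f s (t s)), conj_mul_sum_re (fun s => f s (t' s))]
    exact Finset.sum_le_sum fun s _ =>
      mul_le_mul_of_nonneg_left ((h s).2 _ ⟨_, rfl⟩) (hc s).le

/-- The first end points of the faces add up to the first end point of the face of the sum, and
likewise the second ones. -/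
lemma diam_face_sum (hn : 0 < n) (hc : ∀ s, 0 < c s) (hν : ‖ν‖ = 1) :
    Metric.diam (face (Set.range fun t : Fin m → Fin n => ∑ s, f s (t s) * (c s : ℂ)) ν) =
      ∑ s, c s * Metric.diam (face (Set.range (f s)) ν) := by
  have : Nonempty (Fin n) := ⟨⟨0, hn⟩⟩
  choose e he using fun s => exists_isSide (Set.finite_range (f s)) (Set.range_nonempty (f s)) ν
  choose t1 ht1 using fun s => (he s).1.1
  choose t2 ht2 using fun s => (he s).2.1.1
  have hside : IsSide (Set.range fun t : Fin m → Fin n => ∑ s, f s (t s) * (c s : ℂ)) ν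
      (∑ s, f s (t1 s) * (c s : ℂ), ∑ s, f s (t2 s) * (c s : ℂ)) := by
    refine ⟨(mem_face_sum_iff hc t1).2 fun s => ht1 s ▸ (he s).1,
      (mem_face_sum_iff hc t2).2 fun s => ht2 s ▸ (he s).2.1, ?_⟩
    rintro w ⟨⟨t, rfl⟩, hw⟩
    have ht := (mem_face_sum_iff hc t).1 ⟨⟨t, rfl⟩, hw⟩
    simp only
    rw [conj_mul_sum_im (fun s => f s (t s)), conj_mul_sum_im (fun s => f s (t1 s)),
      conj_mul_sum_im (fun s => f s (t2 s))]
    constructor <;> refine Finset.sum_le_sum fun s _ => mul_le_mul_of_nonneg_left ?_ (hc s).le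
    · rw [ht1]; exact ((he s).2.2 _ (ht s)).1
    · rw [ht2]; exact ((he s).2.2 _ (ht s)).2
  rw [hside.diam_face hν, hside.dist_eq_sub hν]
  simp only
  rw [conj_mul_sum_im (fun s => f s (t1 s)), conj_mul_sum_im (fun s => f s (t2 s)),
    ← Finset.sum_sub_distrib]
  refine Finset.sum_congr rfl fun s _ => ?_
  rw [(he s).diam_face hν, (he s).dist_eq_sub hν, ht1, ht2]; ring

/-- The perimeter is additive under Minkowski sums. -/
lemma perimeter_sum (hn : 0 < n) (hc : ∀ s, 0 < c s) :
    perimeter (convexHull ℝ (Set.range fun t : Fin m → Fin n => ∑ s, f s (t s) * (c s : ℂ))) =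
      ∑ s, c s * perimeter (convexHull ℝ (Set.range (f s))) := by
  have : Nonempty (Fin n) := ⟨⟨0, hn⟩⟩
  have hf := fun s => perimeter_eq_finsum_diam_face (Set.finite_range (f s))
    (Set.range_nonempty (f s))
  rw [(perimeter_eq_finsum_diam_face (Set.finite_range _) (Set.range_nonempty _)).1]
  calc _ = ∑ᶠ ν ∈ Metric.sphere (0 : ℂ) 1, ∑ s, c s * Metric.diam (face (Set.range (f s)) ν) :=
        finsum_mem_congr rfl fun ν hν => diam_face_sum hn hc (by simpa using hν)
    -- A finite set of directions carrying all the summands, so that the two sums may be exchanged.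
    _ = ∑ᶠ ν ∈ ⋃ s, Metric.sphere (0 : ℂ) 1 ∩
          Function.support fun ν => Metric.diam (face (Set.range (f s)) ν),
          ∑ s, c s * Metric.diam (face (Set.range (f s)) ν) := by
        refine finsum_mem_inter_support_eq _ _ _ ?_
        ext ν
        simp only [Set.mem_inter_iff, Set.mem_iUnion, Function.mem_support]
        constructor
        · rintro ⟨h1, h2⟩
          obtain ⟨s, -, hs⟩ := Finset.exists_ne_zero_of_sum_ne_zero h2
          exact ⟨⟨s, h1, right_ne_zero_of_mul hs⟩, h2⟩
        · rintro ⟨⟨s, h1, -⟩, h2⟩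
          exact ⟨h1, h2⟩
    _ = ∑ s, ∑ᶠ ν ∈ ⋃ s, Metric.sphere (0 : ℂ) 1 ∩
          Function.support fun ν => Metric.diam (face (Set.range (f s)) ν),
          c s * Metric.diam (face (Set.range (f s)) ν) := by
        have hfin := Set.finite_iUnion fun s => (hf s).2
        simp only [finsum_mem_eq_finite_toFinset_sum _ hfin]
        exact Finset.sum_comm
    _ = _ := by
        refine Finset.sum_congr rfl fun s _ => ?_
        rw [(hf s).1, ← mul_finsum_mem]
        congr 1
        refine finsum_mem_inter_support_eq _ _ _ ?_
        ext ν
        simp only [Set.mem_inter_iff, Set.mem_iUnion, Function.mem_support]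
        exact ⟨fun ⟨⟨_, h1, _⟩, h2⟩ => ⟨h1, h2⟩, fun ⟨h1, h2⟩ => ⟨⟨s, h1, h2⟩, h2⟩⟩

end Sum

end EllipticSystem

namespace EllipticSystem

/-! ### Zeros of `1 + c exp ζ + h ζ` with small `h` -/

section HalfStrip

/-- The closed half-strip `|Re ζ| ≤ B`, `Im ζ ≤ -Y`. -/
def halfStrip (B Y : ℝ) : Set ℂ := {ζ | |ζ.re| ≤ B ∧ ζ.im ≤ -Y}

lemma convex_halfStrip (B Y : ℝ) : Convex ℝ (halfStrip B Y) := by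
  have : halfStrip B Y = (Complex.reLm ⁻¹' Set.Icc (-B) B) ∩ (Complex.imLm ⁻¹' Set.Iic (-Y)) := by
    ext ζ
    simp [halfStrip, abs_le]
  rw [this]
  exact ((convex_Icc _ _).linear_preimage _).inter ((convex_Iic _).linear_preimage _)

variable {c : ℂ} {h : ℂ → ℂ} {B Y : ℝ}

/-- The zeros of `1 + c exp ζ + h ζ` in a half-strip. -/
def stripZeros (c : ℂ) (h : ℂ → ℂ) (B Y : ℝ) : Set ℂ :=
  {ζ | 1 + c * Complex.exp ζ + h ζ = 0 ∧ ζ ∈ halfStrip B Y}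

/-- At a zero `c exp ζ = -1 - h ζ`, so the derivative of the function is `-1 - h ζ + h' ζ`, of
modulus at least `1/2`: the zeros are simple. -/
lemma deriv_ne_zero_of_mem_stripZeros
    (hs : ∀ ζ ∈ halfStrip B Y, ‖h ζ‖ ≤ 1 / 4 ∧ ‖deriv h ζ‖ ≤ 1 / 4) {ζ : ℂ}
    (hζ : ζ ∈ stripZeros c h B Y) : c * Complex.exp ζ + deriv h ζ ≠ 0 := by
  obtain ⟨h0, hR⟩ := hζ
  obtain ⟨h1, h2⟩ := hs ζ hR
  intro h3
  have h4 : (1 : ℂ) = deriv h ζ - h ζ := by linear_combination h0 - h3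
  have h5 := norm_sub_le (deriv h ζ) (h ζ)
  rw [← h4, norm_one] at h5
  linarith

/-- The derivative `h' / (1 + h)` is at most `(1/4) / (3/4)`. This contraction constant yields both
existence and uniqueness of the zero on each branch of the logarithm. -/
lemma norm_log_one_add_sub_le (hd : Differentiable ℂ h)
    (hs : ∀ ζ ∈ halfStrip B Y, ‖h ζ‖ ≤ 1 / 4 ∧ ‖deriv h ζ‖ ≤ 1 / 4) {x y : ℂ}
    (hx : x ∈ halfStrip B Y) (hy : y ∈ halfStrip B Y) :
    ‖Complex.log (1 + h y) - Complex.log (1 + h x)‖ ≤ 1 / 3 * ‖y - x‖ := by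
  have key : ∀ ζ ∈ halfStrip B Y, 3 / 4 ≤ ‖1 + h ζ‖ ∧ 1 + h ζ ∈ Complex.slitPlane := by
    intro ζ hζ
    have h1 := (hs ζ hζ).1
    constructor
    · have := norm_sub_norm_le (1 : ℂ) (-h ζ)
      rw [norm_one, norm_neg, sub_neg_eq_add] at this
      linarith
    · exact Complex.mem_slitPlane_of_norm_lt_one (by linarith)
  refine (convex_halfStrip B Y).norm_image_sub_le_of_norm_hasDerivWithin_le
    (f := fun ζ => Complex.log (1 + h ζ)) (f' := fun ζ => deriv h ζ / (1 + h ζ))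
    (fun ζ hζ => ?_) (fun ζ hζ => ?_) hx hy
  · exact (((hd ζ).hasDerivAt.const_add 1).clog (key ζ hζ).2).hasDerivWithinAt
  · rw [norm_div, div_le_iff₀ (by linarith [(key ζ hζ).1])]
    linarith [(key ζ hζ).1, (hs ζ hζ).2]

lemma norm_log_one_add_le_one {w : ℂ} (hw : ‖w‖ ≤ 1 / 4) : ‖Complex.log (1 + w)‖ ≤ 1 := by
  have := Complex.norm_log_one_add_half_le_self (z := w) (by linarith)
  linarith

/-- Taking logarithms turns the equation into one fixed-point equation for each branch `k`. -/
lemma zero_iff_exists_int (hc : c ≠ 0) {ζ : ℂ} (hh : ‖h ζ‖ ≤ 1 / 4) :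
    1 + c * Complex.exp ζ + h ζ = 0 ↔
      ∃ k : ℤ, ζ = Complex.log (-1 / c) + Complex.log (1 + h ζ) + k * (2 * Real.pi * Complex.I) := by
  have h1 : 1 + h ζ ≠ 0 := by
    intro h1
    have : h ζ = -1 := by linear_combination h1
    rw [this] at hh
    norm_num at hh
  have h2 : -1 / c ≠ 0 := div_ne_zero (by norm_num) hc
  rw [← Complex.exp_eq_exp_iff_exists_int, Complex.exp_add, Complex.exp_log h2, Complex.exp_log h1]
  constructor
  · intro h3
    field_simp
    linear_combination h3
  · intro h3
    rw [h3]
    field_simp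
    ring

/-- Banach's fixed-point theorem on the unit ball about the zero of the unperturbed equation `1 + c
exp ζ = 0`. -/
lemma exists_zero_near (hd : Differentiable ℂ h)
    (hs : ∀ ζ ∈ halfStrip B Y, ‖h ζ‖ ≤ 1 / 4 ∧ ‖deriv h ζ‖ ≤ 1 / 4) (k : ℤ)
    (hk : Metric.closedBall (Complex.log (-1 / c) + k * (2 * Real.pi * Complex.I)) 1 ⊆
      halfStrip B Y) :
    ∃ ζ ∈ halfStrip B Y,
      ζ = Complex.log (-1 / c) + Complex.log (1 + h ζ) + k * (2 * Real.pi * Complex.I) := by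
  set q := Complex.log (-1 / c) + k * (2 * Real.pi * Complex.I) with hq
  set T : ℂ → ℂ := fun ζ => q + Complex.log (1 + h ζ) with hT
  have hmaps : Set.MapsTo T (Metric.closedBall q 1) (Metric.closedBall q 1) := by
    intro ζ hζ
    rw [Metric.mem_closedBall, dist_eq_norm]
    simpa [hT] using norm_log_one_add_le_one (hs ζ (hk hζ)).1
  have hcontr : ContractingWith (1 / 3) (hmaps.restrict T _ _) := by
    refine ⟨by rw [div_lt_one (by norm_num)]; norm_num, LipschitzWith.of_dist_le_mul ?_⟩
    rintro ⟨x, hx⟩ ⟨y, hy⟩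
    rw [Subtype.dist_eq, Subtype.dist_eq, dist_eq_norm, dist_eq_norm]
    have := norm_log_one_add_sub_le hd hs (hk hy) (hk hx)
    simpa [hT] using this
  obtain ⟨ζ, hζ, hfix, -⟩ := hcontr.exists_fixedPoint' Metric.isClosed_closedBall.isComplete hmaps
    (x := q) (by simp) (edist_ne_top _ _)
  refine ⟨ζ, hk hζ, ?_⟩
  have : T ζ = ζ := hfix
  rw [hT, hq] at this
  simp only at this
  linear_combination -this

lemma card_Icc_int_bounds (a b : ℤ) : (b : ℝ) - a ≤ (Finset.Icc a b).card := by
  rw [Int.card_Icc]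
  have : b - a ≤ ((b + 1 - a).toNat : ℤ) := by omega
  exact_mod_cast this

/-- In a half-strip in which `h` and its derivative are small, the zeros of `1 + c exp ζ + h ζ` are
asymptotically equidistant with distance `2 π`. -/
lemma exists_bound_ncard_stripZeros (hc : c ≠ 0) (hd : Differentiable ℂ h)
    (hs : ∀ ζ ∈ halfStrip B Y, ‖h ζ‖ ≤ 1 / 4 ∧ ‖deriv h ζ‖ ≤ 1 / 4)
    (hB : ‖Complex.log (-1 / c)‖ + 1 ≤ B) (hY : ‖Complex.log (-1 / c)‖ + 1 < Y) :
    ∃ C : ℝ, ∀ E : ℝ, 0 ≤ E → (stripZeros c h B Y ∩ {ζ | ‖ζ‖ ≤ E}).Finite ∧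
      |((stripZeros c h B Y ∩ {ζ | ‖ζ‖ ≤ E}).ncard : ℝ) - E / (2 * Real.pi)| ≤ C := by
  have hπ := Real.pi_pos
  set κ := Complex.log (-1 / c) with hκ
  set D := ‖κ‖ + 1 with hD
  have hD0 : 0 < D := by positivity
  have hex : ∀ ζ ∈ stripZeros c h B Y, ∃ k : ℤ,
      ζ = κ + Complex.log (1 + h ζ) + k * (2 * Real.pi * Complex.I) :=
    fun ζ hζ => (zero_iff_exists_int hc (hs ζ hζ.2).1).1 hζ.1
  choose! k hk using hex
  have hnear : ∀ ζ ∈ stripZeros c h B Y, ‖ζ - k ζ * (2 * Real.pi * Complex.I)‖ ≤ D := by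
    intro ζ hζ
    have : ζ - k ζ * (2 * Real.pi * Complex.I) = κ + Complex.log (1 + h ζ) := by
      linear_combination hk ζ hζ
    rw [this]
    exact (norm_add_le _ _).trans (add_le_add le_rfl (norm_log_one_add_le_one (hs ζ hζ.2).1))
  -- `Im ζ ≤ -Y < -D`, while `Im ζ` is within `D` of `2πk`.
  have hneg : ∀ ζ ∈ stripZeros c h B Y, k ζ < 0 := by
    intro ζ hζ
    have h1 := (Complex.abs_im_le_norm _).trans (hnear ζ hζ)
    have h2 : (ζ - k ζ * (2 * Real.pi * Complex.I)).im = ζ.im - k ζ * (2 * Real.pi) := by simp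
    rw [h2, abs_le] at h1
    have h3 := hζ.2.2
    have : (k ζ : ℝ) * (2 * Real.pi) < 0 := by linarith
    have : (k ζ : ℝ) < 0 := by
      by_contra! h4
      exact absurd this (not_lt.2 (by positivity))
    exact_mod_cast this
  have hnorm : ∀ j : ℤ, j ≤ 0 → ‖(j : ℂ) * (2 * Real.pi * Complex.I)‖ = -(j : ℝ) * (2 * Real.pi) := by
    intro j hj
    have hj' : (j : ℝ) ≤ 0 := by exact_mod_cast hj
    simp [abs_of_nonpos hj', abs_of_pos hπ]
  -- Two zeros on the same branch would be fixed points of the same contraction.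
  have hinj : Set.InjOn (fun ζ => -k ζ) (stripZeros c h B Y) := by
    intro x hx y hy hxy
    have hxy : k x = k y := neg_injective hxy
    have h1 := norm_log_one_add_sub_le hd hs hx.2 hy.2
    have h2 : Complex.log (1 + h y) - Complex.log (1 + h x) = y - x := by
      have h3 := hk x hx
      have h4 := hk y hy
      rw [hxy] at h3
      linear_combination h3 - h4
    rw [h2] at h1
    have : ‖y - x‖ = 0 := by linarith [norm_nonneg (y - x)]
    exact (sub_eq_zero.1 (norm_eq_zero.1 this)).symm
  -- For every branch `k ≤ -N0` the unit ball of `exists_zero_near` lies below height `-Y`, so the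
  -- branch carries a zero.
  obtain ⟨N0, hN0⟩ := exists_nat_gt ((Y + D) / (2 * Real.pi))
  rw [div_lt_iff₀ (by positivity)] at hN0
  refine ⟨D / (2 * Real.pi) + N0 + 1, fun E hE => ?_⟩
  set A := stripZeros c h B Y ∩ {ζ | ‖ζ‖ ≤ E} with hA
  have himg : ∀ ζ ∈ A, -k ζ ∈ Finset.Icc (1 : ℤ) ⌊(E + D) / (2 * Real.pi)⌋ := by
    rintro ζ ⟨hζ, hζE⟩
    have h1 := hneg ζ hζ
    rw [Finset.mem_Icc]
    refine ⟨by omega, ?_⟩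
    rw [Int.le_floor, le_div_iff₀ (by positivity)]
    push_cast
    rw [← hnorm _ h1.le]
    have h2 := norm_sub_norm_le ((k ζ : ℂ) * (2 * Real.pi * Complex.I)) ζ
    rw [norm_sub_rev] at h2
    have : ‖ζ‖ ≤ E := hζE
    linarith [hnear ζ hζ]
  have hfin : A.Finite := Set.Finite.of_injOn (f := fun ζ => -k ζ)
    (t := ↑(Finset.Icc (1 : ℤ) ⌊(E + D) / (2 * Real.pi)⌋)) himg
    (hinj.mono Set.inter_subset_left) (Finset.finite_toSet _)
  refine ⟨hfin, ?_⟩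
  have hupper : (A.ncard : ℝ) ≤ (E + D) / (2 * Real.pi) := by
    have h1 := Set.ncard_le_ncard_of_injOn (fun ζ => -k ζ) himg (hinj.mono Set.inter_subset_left)
      (Finset.finite_toSet _)
    rw [Set.ncard_coe_finset, Int.card_Icc] at h1
    have h2 : 0 ≤ ⌊(E + D) / (2 * Real.pi)⌋ := Int.floor_nonneg.2 (by positivity)
    have h3 : (A.ncard : ℤ) ≤ ⌊(E + D) / (2 * Real.pi)⌋ := by omega
    calc (A.ncard : ℝ) = ((A.ncard : ℤ) : ℝ) := by simp
      _ ≤ (⌊(E + D) / (2 * Real.pi)⌋ : ℤ) := by exact_mod_cast h3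
      _ ≤ _ := Int.floor_le _
  have hexz : ∀ j ∈ Finset.Icc (N0 : ℤ) ⌊(E - D) / (2 * Real.pi)⌋,
      ∃ ζ ∈ A, ζ = κ + Complex.log (1 + h ζ) + (-j : ℤ) * (2 * Real.pi * Complex.I) := by
    intro j hj
    rw [Finset.mem_Icc, Int.le_floor, le_div_iff₀ (by positivity)] at hj
    have hj1 : (N0 : ℝ) ≤ j := by exact_mod_cast hj.1
    have hj0 : (-j : ℤ) ≤ 0 := by have := hj.1; omega
    have hball : Metric.closedBall (κ + (-j : ℤ) * (2 * Real.pi * Complex.I)) 1 ⊆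
        halfStrip B Y := by
      intro w hw
      rw [Metric.mem_closedBall, dist_eq_norm] at hw
      have h1 := (Complex.abs_re_le_norm _).trans hw
      have h2 := (Complex.abs_im_le_norm _).trans hw
      have h3 : (w - (κ + (-j : ℤ) * (2 * Real.pi * Complex.I))).re = w.re - κ.re := by simp
      have h4 : (w - (κ + (-j : ℤ) * (2 * Real.pi * Complex.I))).im =
          w.im - κ.im + j * (2 * Real.pi) := by simp; ring
      rw [h3, abs_le] at h1
      rw [h4, abs_le] at h2
      have h5 := abs_le.1 (Complex.abs_re_le_norm κ)
      have h6 := abs_le.1 (Complex.abs_im_le_norm κ)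
      have h7 : (N0 : ℝ) * (2 * Real.pi) ≤ j * (2 * Real.pi) := by gcongr
      refine ⟨abs_le.2 ⟨by linarith, by linarith⟩, by linarith⟩
    obtain ⟨ζ, hζ, hfix⟩ := exists_zero_near hd hs (-j) hball
    refine ⟨ζ, ⟨⟨(zero_iff_exists_int hc (hs ζ hζ).1).2 ⟨_, hfix⟩, hζ⟩, ?_⟩, hfix⟩
    have h1 : ‖ζ‖ ≤ ‖κ + Complex.log (1 + h ζ)‖ + ‖((-j : ℤ) : ℂ) * (2 * Real.pi * Complex.I)‖ := by
      conv_lhs => rw [hfix]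
      exact norm_add_le _ _
    have h2 : ‖κ + Complex.log (1 + h ζ)‖ ≤ D :=
      (norm_add_le _ _).trans (add_le_add le_rfl (norm_log_one_add_le_one (hs ζ hζ).1))
    rw [hnorm _ hj0] at h1
    push_cast at h1
    change ‖ζ‖ ≤ E
    linarith [hj.2]
  choose! Z hZA hZ using hexz
  have hlower : (E - D) / (2 * Real.pi) - 1 - N0 ≤ A.ncard := by
    have h1 := Set.ncard_le_ncard_of_injOn
      (s := ↑(Finset.Icc (N0 : ℤ) ⌊(E - D) / (2 * Real.pi)⌋)) Z hZA (fun i hi j hj hij => ?_) hfin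
    · rw [Set.ncard_coe_finset] at h1
      have h2 := card_Icc_int_bounds (N0 : ℤ) ⌊(E - D) / (2 * Real.pi)⌋
      have h3 := Int.lt_floor_add_one ((E - D) / (2 * Real.pi))
      have h4 : ((Finset.Icc (N0 : ℤ) ⌊(E - D) / (2 * Real.pi)⌋).card : ℝ) ≤ A.ncard := by
        exact_mod_cast h1
      rw [Int.cast_natCast] at h2
      linarith
    · have h1 := hZ i hi
      have h2 := hZ j hj
      rw [hij] at h1
      have h3 : (((-i : ℤ) : ℂ) - ((-j : ℤ) : ℂ)) * (2 * Real.pi * Complex.I) = 0 := by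
        linear_combination h2 - h1
      have h4 := (mul_eq_zero.1 h3).resolve_right Complex.two_pi_I_ne_zero
      have h5 : (-i : ℤ) = -j := by exact_mod_cast sub_eq_zero.1 h4
      omega
  have e1 : (E + D) / (2 * Real.pi) = E / (2 * Real.pi) + D / (2 * Real.pi) := add_div _ _ _
  have e2 : (E - D) / (2 * Real.pi) = E / (2 * Real.pi) - D / (2 * Real.pi) := sub_div _ _ _
  rw [e1] at hupper
  rw [e2] at hlower
  have : (0 : ℝ) ≤ N0 := Nat.cast_nonneg _
  rw [abs_le]
  constructor <;> linarith

end HalfStrip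

end EllipticSystem

namespace EllipticSystem

/-! ### Zeros of generic exponential sums -/

open scoped ComplexConjugate Topology

section ExpSum

/-- The exponential sum `∑ w ∈ S, δ w exp (z conj w)`. -/
noncomputable def expSum (S : Finset ℂ) (δ : ℂ → ℂ) (z : ℂ) : ℂ :=
  ∑ w ∈ S, δ w * Complex.exp (z * conj w)

/-- The coefficients of the vertices of the convex hull of `S` do not vanish, and no point of `S`
lies within an edge. -/
def GenericSum (S : Finset ℂ) (δ : ℂ → ℂ) : Prop :=
  (∀ w ∈ (convexHull ℝ (S : Set ℂ)).extremePoints ℝ, δ w ≠ 0) ∧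
    ∀ e ∈ edges (convexHull ℝ (S : Set ℂ)), ∀ w ∈ S, w ∉ openSegment ℝ e.1 e.2

variable {S : Finset ℂ} {δ : ℂ → ℂ}

lemma differentiable_expSum (S : Finset ℂ) (δ : ℂ → ℂ) : Differentiable ℂ (expSum S δ) := by
  unfold expSum
  fun_prop

lemma expSum_eq (S : Finset ℂ) (δ : ℂ → ℂ) (w₀ z : ℂ) :
    expSum S δ z = Complex.exp (z * conj w₀) * ∑ w ∈ S, δ w * Complex.exp (z * conj (w - w₀)) := by
  rw [expSum, Finset.mul_sum]
  refine Finset.sum_congr rfl fun w _ => ?_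
  have : z * conj w = z * conj w₀ + z * conj (w - w₀) := by rw [map_sub]; ring
  rw [this, Complex.exp_add]; ring

lemma IsSide.mem_openSegment {S : Set ℂ} {ν : ℂ} {e : ℂ × ℂ} (hν : ‖ν‖ = 1) (h : IsSide S ν e)
    {w : ℂ} (hw : w ∈ face S ν) : w = e.1 ∨ w = e.2 ∨ w ∈ openSegment ℝ e.1 e.2 := by
  by_cases h1 : w = e.1
  · exact Or.inl h1
  by_cases h2 : w = e.2
  · exact Or.inr (Or.inl h2)
  refine Or.inr (Or.inr ?_)
  have hb := h.2.2 w hw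
  set x := (conj ν * e.1).im with hx
  set y := (conj ν * e.2).im with hy
  set i := (conj ν * w).im with hi
  have h1' : x < i := lt_of_le_of_ne hb.1 fun he =>
    h1 (conj_mul_cancel hν (face_re_eq hw h.1) he.symm)
  have h2' : i < y := lt_of_le_of_ne hb.2 fun he =>
    h2 (conj_mul_cancel hν (face_re_eq hw h.2.1) he)
  have hxy : 0 < y - x := by linarith
  refine ⟨(y - i) / (y - x), (i - x) / (y - x), div_pos (by linarith) hxy,
    div_pos (by linarith) hxy, by field_simp; ring, conj_mul_cancel hν ?_ ?_⟩
  · have : (conj ν * (((y - i) / (y - x)) • e.1 + ((i - x) / (y - x)) • e.2)).re =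
        (y - i) / (y - x) * (conj ν * e.1).re + (i - x) / (y - x) * (conj ν * e.2).re := by
      generalize (y - i) / (y - x) = s
      generalize (i - x) / (y - x) = s'
      simp; ring
    rw [this, face_re_eq h.1 hw, face_re_eq h.2.1 hw]
    field_simp; ring
  · have : (conj ν * (((y - i) / (y - x)) • e.1 + ((i - x) / (y - x)) • e.2)).im =
        (y - i) / (y - x) * x + (i - x) / (y - x) * y := by
      rw [hx, hy]
      generalize (y - i) / (y - x) = s
      generalize (i - x) / (y - x) = s'
      simp; ring
    rw [this, ← hi]
    field_simp; ring

lemma GenericSum.eq_of_mem_face (hg : GenericSum S δ) {ν : ℂ} {e : ℂ × ℂ} (hν : ‖ν‖ = 1)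
    (h : IsSide (S : Set ℂ) ν e) {w : ℂ} (hw : w ∈ face (S : Set ℂ) ν) : w = e.1 ∨ w = e.2 := by
  rcases h.mem_openSegment hν hw with h1 | h1 | h1
  · exact Or.inl h1
  · exact Or.inr h1
  · by_cases he : e.1 = e.2
    · rw [he, openSegment_same] at h1
      exact Or.inr h1
    · exact absurd h1 (hg.2 e (h.mem_edges hν he) w hw.1)

/-- Genericity empties the interiors of the edges, so every term other than those of the two end
points is strictly dominated. -/
lemma GenericSum.re_lt (hg : GenericSum S δ) {ν : ℂ} {e : ℂ × ℂ} (hν : ‖ν‖ = 1)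
    (h : IsSide (S : Set ℂ) ν e) {w : ℂ} (hw : w ∈ S) (h1 : w ≠ e.1) (h2 : w ≠ e.2) :
    (conj ν * w).re < (conj ν * e.1).re := by
  refine lt_of_le_of_ne (h.1.2 w hw) fun he => ?_
  rcases hg.eq_of_mem_face hν h (w := w) ⟨hw, fun w' hw' => he ▸ h.1.2 w' hw'⟩ with h3 | h3
  · exact h1 h3
  · exact h2 h3

lemma tendsto_exp_mul_conj {z : ℕ → ℂ} {ν w : ℂ} (hz : Tendsto (fun n => ‖z n‖) atTop atTop)
    (hν : Tendsto (fun n => z n / ‖z n‖) atTop (𝓝 ν)) (hw : (conj ν * w).re < 0) :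
    Tendsto (fun n => Complex.exp (z n * conj w)) atTop (𝓝 0) := by
  rw [Complex.tendsto_exp_nhds_zero_iff]
  have h1 : Tendsto (fun n => (z n / ‖z n‖ * conj w).re) atTop (𝓝 (ν * conj w).re) :=
    (Complex.continuous_re.tendsto _).comp (hν.mul_const _)
  have h2 : (ν * conj w).re = (conj ν * w).re := by simp
  rw [h2] at h1
  refine (hz.atTop_mul_neg hw h1).congr' ?_
  filter_upwards [hz.eventually_gt_atTop 0] with n hn
  have : z n * conj w = (‖z n‖ : ℂ) * (z n / ‖z n‖ * conj w) := by
    have : (‖z n‖ : ℂ) ≠ 0 := by exact_mod_cast hn.ne'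
    field_simp
  rw [this, Complex.re_ofReal_mul]

/-- A logarithm of the quotient of the coefficients of the end points of an edge. -/
noncomputable def edgeShift (δ : ℂ → ℂ) (e : ℂ × ℂ) : ℂ := Complex.log (-1 / (δ e.2 / δ e.1))

lemma edgeShift_re (δ : ℂ → ℂ) (e : ℂ × ℂ) :
    (edgeShift δ e).re = Real.log (‖δ e.1‖ / ‖δ e.2‖) := by
  rw [edgeShift, Complex.log_re, norm_div, norm_neg, norm_one, norm_div, one_div_div]

/-- After division by `exp (z conj e.1)` the terms off the face in the limit direction tend to `0`,
so the remaining one or two terms must cancel in the limit. -/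
lemma GenericSum.eventually_mem_halfStrip (hg : GenericSum S δ) (hS : S.Nonempty) {B : ℝ}
    (hB : ∀ e ∈ edges (convexHull ℝ (S : Set ℂ)), ‖edgeShift δ e‖ + 1 ≤ B) (Y : ℝ)
    {z : ℕ → ℂ} {ν : ℂ} (hz : Tendsto (fun n => ‖z n‖) atTop atTop) (hν1 : ‖ν‖ = 1)
    (hν : Tendsto (fun n => z n / ‖z n‖) atTop (𝓝 ν)) (hF : ∀ n, expSum S δ (z n) = 0) :
    ∃ e ∈ edges (convexHull ℝ (S : Set ℂ)),
      ∀ᶠ n in atTop, z n * conj (e.2 - e.1) ∈ halfStrip B Y := by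
  obtain ⟨e, he⟩ := exists_isSide S.finite_toSet (by simpa using hS) ν
  have hsum : ∀ n, ∑ w ∈ S, δ w * Complex.exp (z n * conj (w - e.1)) = 0 := by
    intro n
    have := hF n
    rw [expSum_eq S δ e.1] at this
    exact (mul_eq_zero.1 this).resolve_left (Complex.exp_ne_zero _)
  have hrest : Tendsto (fun n => ∑ w ∈ (S.erase e.1).erase e.2,
      δ w * Complex.exp (z n * conj (w - e.1))) atTop (𝓝 0) := by
    rw [← Finset.sum_const_zero (s := (S.erase e.1).erase e.2)]
    refine tendsto_finsetSum _ fun w hw => ?_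
    rw [Finset.mem_erase, Finset.mem_erase] at hw
    have hlt := hg.re_lt hν1 he hw.2.2 hw.2.1 hw.1
    have := tendsto_exp_mul_conj (w := w - e.1) hz hν (by rw [mul_sub, Complex.sub_re]; linarith)
    simpa using this.const_mul (δ w)
  have hδ1 : δ e.1 ≠ 0 := hg.1 _ (he.fst_mem hν1)
  have hδ2 : δ e.2 ≠ 0 := hg.1 _ (he.snd_mem hν1)
  have hm1 : e.1 ∈ S := he.1.1
  by_cases hne : e.1 = e.2
  -- The face is a single vertex: nothing can cancel its coefficient, which would have to be `0`.
  · exfalso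
    have h1 : ∀ n, δ e.1 = -∑ w ∈ (S.erase e.1).erase e.2,
        δ w * Complex.exp (z n * conj (w - e.1)) := by
      intro n
      have := hsum n
      rw [← Finset.add_sum_erase _ _ hm1, sub_self, map_zero, mul_zero, Complex.exp_zero,
        mul_one] at this
      rw [← hne, Finset.erase_idem]
      linear_combination this
    have h2 := hrest.neg
    simp only [← h1, neg_zero] at h2
    exact hδ1 (tendsto_const_nhds_iff.1 h2)
  · refine ⟨e, he.mem_edges hν1 hne, ?_⟩
    have hm2 : e.2 ∈ S.erase e.1 := Finset.mem_erase.2 ⟨Ne.symm hne, he.2.1.1⟩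
    have h1 : ∀ n, Complex.exp (z n * conj (e.2 - e.1)) = (-δ e.1 -
        ∑ w ∈ (S.erase e.1).erase e.2, δ w * Complex.exp (z n * conj (w - e.1))) / δ e.2 := by
      intro n
      have := hsum n
      rw [← Finset.add_sum_erase _ _ hm1, ← Finset.add_sum_erase _ _ hm2, sub_self, map_zero,
        mul_zero, Complex.exp_zero, mul_one] at this
      field_simp
      linear_combination this
    -- `exp (z conj (e.2 - e.1))` tends to `-δ e.1 / δ e.2`; the logarithm of the modulus controls
    -- the real part of the exponent.
    have h2 := ((hrest.const_sub (-δ e.1)).div_const (δ e.2)).norm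
    simp only [← h1, sub_zero, norm_div, norm_neg, Complex.norm_exp] at h2
    have h3 := h2.log (div_ne_zero (norm_ne_zero_iff.2 hδ1) (norm_ne_zero_iff.2 hδ2))
    simp only [Real.log_exp, ← edgeShift_re] at h3
    have hre : ∀ᶠ n in atTop, |(z n * conj (e.2 - e.1)).re| ≤ B := by
      filter_upwards [Metric.tendsto_nhds.1 h3 1 one_pos] with n hn
      rw [Real.dist_eq] at hn
      have h4 := Complex.abs_re_le_norm (edgeShift δ e)
      have h5 := hB e (he.mem_edges hν1 hne)
      have h6 := abs_sub_abs_le_abs_sub (z n * conj (e.2 - e.1)).re (edgeShift δ e).re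
      linarith
    have him : Tendsto (fun n => (z n * conj (e.2 - e.1)).im) atTop atBot := by
      have h4 : Tendsto (fun n => (z n / ‖z n‖ * conj (e.2 - e.1)).im) atTop
          (𝓝 (ν * conj (e.2 - e.1)).im) :=
        (Complex.continuous_im.tendsto _).comp (hν.mul_const _)
      have h5 : (ν * conj (e.2 - e.1)).im = -dist e.1 e.2 := by
        have : ν * conj (e.2 - e.1) = -(dist e.1 e.2 * Complex.I) * (ν * conj ν) := by
          rw [he.sub_eq hν1]; simp; ring
        rw [this, mul_conj_of_norm_one hν1]; simp
      rw [h5] at h4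
      refine (hz.atTop_mul_neg (neg_neg_of_pos (dist_pos.2 hne)) h4).congr' ?_
      filter_upwards [hz.eventually_gt_atTop 0] with n hn
      have : z n * conj (e.2 - e.1) = (‖z n‖ : ℂ) * (z n / ‖z n‖ * conj (e.2 - e.1)) := by
        have : (‖z n‖ : ℂ) ≠ 0 := by exact_mod_cast hn.ne'
        field_simp
      rw [this, Complex.im_ofReal_mul]
    filter_upwards [hre, him.eventually_le_atBot (-Y)] with n h6 h7 using ⟨h6, h7⟩

/-- All zeros outside some disc lie in half-strips perpendicular to the edges. -/
lemma GenericSum.exists_edge_of_zero (hg : GenericSum S δ) (hS : S.Nonempty) {B : ℝ}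
    (hB : ∀ e ∈ edges (convexHull ℝ (S : Set ℂ)), ‖edgeShift δ e‖ + 1 ≤ B) (Y : ℝ) :
    ∃ R : ℝ, ∀ z, expSum S δ z = 0 → R ≤ ‖z‖ →
      ∃ e ∈ edges (convexHull ℝ (S : Set ℂ)), z * conj (e.2 - e.1) ∈ halfStrip B Y := by
  -- Counterexamples of arbitrarily large modulus have, by compactness of the circle, a subsequence
  -- with convergent directions.
  by_contra! hcon
  choose z hF hR hno using fun n : ℕ => hcon (n + 1)
  have hpos : ∀ n, 0 < ‖z n‖ := fun n => by
    have : (0 : ℝ) ≤ n := Nat.cast_nonneg n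
    linarith [hR n]
  have hsph : ∀ n, z n / ‖z n‖ ∈ Metric.sphere (0 : ℂ) 1 := by
    intro n
    simp [(norm_pos_iff.1 (hpos n))]
  obtain ⟨ν, hν1, φ, hφ, hν⟩ := (isCompact_sphere (0 : ℂ) 1).tendsto_subseq hsph
  have hz : Tendsto (fun n => ‖z n‖) atTop atTop :=
    tendsto_atTop_mono (fun n => by linarith [hR n]) tendsto_natCast_atTop_atTop
  obtain ⟨e, he, hev⟩ := hg.eventually_mem_halfStrip hS hB Y (z := z ∘ φ)
    (hz.comp hφ.tendsto_atTop) (by simpa using hν1) hν fun n => hF _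
  obtain ⟨n, hn⟩ := hev.exists
  exact hno (φ n) e he hn

/-- In the `z`-plane these are half-strips of bounded width running along the normals. Distinct
edges have distinct normals, so the half-strips separate far out. -/
lemma eventually_not_mem_halfStrip {S : Set ℂ} {e e' : ℂ × ℂ} (he : e ∈ edges (convexHull ℝ S))
    (he' : e' ∈ edges (convexHull ℝ S)) (hne : e ≠ e') (B : ℝ) :
    ∀ᶠ Y : ℝ in atTop, ∀ z : ℂ, z * conj (e.2 - e.1) ∈ halfStrip B Y →
      z * conj (e'.2 - e'.1) ∉ halfStrip B Y := by
  obtain ⟨ν, hν, hs⟩ := exists_isSide_of_mem_edges he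
  obtain ⟨ν', hν', hs'⟩ := exists_isSide_of_mem_edges he'
  have hd1 := hs.sub_eq hν
  have hd2 := hs'.sub_eq hν'
  have hp : 0 < dist e.1 e.2 := dist_pos.2 he.2.2.1
  have hp' : 0 < dist e'.1 e'.2 := dist_pos.2 he'.2.2.1
  have hνν : ν ≠ ν' := fun h => hne (hs.unique hν (h ▸ hs'))
  set d := e.2 - e.1 with hd
  set d' := e'.2 - e'.1 with hd'
  have hn : ‖d‖ = dist e.1 e.2 := by rw [dist_comm, dist_eq_norm]
  have hn' : ‖d'‖ = dist e'.1 e'.2 := by rw [dist_comm, dist_eq_norm]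
  have hdsq : d.re ^ 2 + d.im ^ 2 = ‖d‖ ^ 2 := by
    rw [← Complex.normSq_eq_norm_sq, Complex.normSq_apply]; ring
  set Δ := d.re * d'.im - d.im * d'.re with hΔ
  set α := d.re * d'.re + d.im * d'.im with hα
  -- Both identities are parts of `‖d‖² z conj d' = (z conj d)(α - Δ I)`.
  have key1 : ∀ z : ℂ, ‖d‖ ^ 2 * (z * conj d').re = α * (z * conj d).re + Δ * (z * conj d).im := by
    intro z; rw [← hdsq, hα, hΔ]; simp; ring
  have key2 : ∀ z : ℂ, ‖d‖ ^ 2 * (z * conj d').im = α * (z * conj d).im - Δ * (z * conj d).re := by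
    intro z; rw [← hdsq, hα, hΔ]; simp; ring
  by_cases hΔ0 : Δ = 0
  · filter_upwards [eventually_gt_atTop 0] with Y hY z hz hz'
    -- Parallel edges with the same orientation would have the same normal; hence they are
    -- antiparallel, and the two imaginary parts have opposite signs.
    have h1 : α ≠ ‖d‖ * ‖d'‖ := by
      intro h1
      apply hνν
      have h2 : (‖d‖ ^ 2 : ℂ) * d' = (‖d‖ * ‖d'‖) * d := by
        have h3 : (‖d‖ ^ 2 : ℂ) = ((d.re ^ 2 + d.im ^ 2 : ℝ) : ℂ) := by rw [hdsq]; push_cast; rfl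
        have h4 : (‖d‖ * ‖d'‖ : ℂ) = (α : ℂ) := by rw [h1]; push_cast; rfl
        rw [h3, h4, hα]
        apply Complex.ext
        · simp only [Complex.re_ofReal_mul]; linear_combination (-d.im) * hΔ0
        · simp only [Complex.im_ofReal_mul]; linear_combination (d.re) * hΔ0
      have hdC : (‖d‖ : ℂ) ≠ 0 := by rw [hn]; exact_mod_cast hp.ne'
      have hdC' : (‖d'‖ : ℂ) ≠ 0 := by rw [hn']; exact_mod_cast hp'.ne'
      rw [← hn] at hd1
      rw [← hn'] at hd2
      have h5 : (‖d‖ ^ 2 * ‖d'‖ * Complex.I : ℂ) * ν = (‖d‖ ^ 2 * ‖d'‖ * Complex.I : ℂ) * ν' := by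
        linear_combination (-1 : ℂ) * h2 + (‖d‖ : ℂ) ^ 2 * hd2 - (‖d‖ * ‖d'‖ : ℂ) * hd1
      exact mul_left_cancel₀ (by simp [hdC, hdC']) h5
    have h2 : α ^ 2 = (‖d‖ * ‖d'‖) ^ 2 := by
      have hdsq' : d'.re ^ 2 + d'.im ^ 2 = ‖d'‖ ^ 2 := by
        rw [← Complex.normSq_eq_norm_sq, Complex.normSq_apply]; ring
      rw [mul_pow, ← hdsq, ← hdsq', hα]
      linear_combination (-Δ) * hΔ0 + (Δ + (d.re * d'.im - d.im * d'.re)) * hΔ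
    have h3 : α = -(‖d‖ * ‖d'‖) := (sq_eq_sq_iff_eq_or_eq_neg.1 h2).resolve_left h1
    have h4 : α < 0 := by
      rw [h3, hn, hn']
      exact neg_neg_of_pos (mul_pos hp hp')
    have h5 := key2 z
    rw [hΔ0, zero_mul, sub_zero] at h5
    have h6 : 0 < α * (z * conj d).im := mul_pos_of_neg_of_neg h4 (by linarith [hz.2])
    have h7 : ‖d‖ ^ 2 * (z * conj d').im ≤ 0 :=
      mul_nonpos_of_nonneg_of_nonpos (by positivity) (by linarith [hz'.2])
    linarith
  · have hΔp : 0 < |Δ| := abs_pos.2 hΔ0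
    filter_upwards [eventually_gt_atTop 0,
      eventually_gt_atTop ((‖d‖ ^ 2 * B + |α| * B) / |Δ|)] with Y hY hYB z hz hz'
    rw [div_lt_iff₀ hΔp] at hYB
    have h1 : Δ * (z * conj d).im = ‖d‖ ^ 2 * (z * conj d').re - α * (z * conj d).re := by
      linear_combination -key1 z
    have h2 := congrArg abs h1
    rw [abs_mul] at h2
    have h3 : Y ≤ |(z * conj d).im| := by
      rw [abs_of_neg (by linarith [hz.2])]; linarith [hz.2]
    have h4 : |‖d‖ ^ 2 * (z * conj d').re - α * (z * conj d).re| ≤ ‖d‖ ^ 2 * B + |α| * B := by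
      refine (abs_sub _ _).trans ?_
      rw [abs_mul, abs_mul, abs_of_nonneg (sq_nonneg ‖d‖)]
      exact add_le_add (mul_le_mul_of_nonneg_left hz'.1 (sq_nonneg _))
        (mul_le_mul_of_nonneg_left hz.1 (abs_nonneg _))
    have h5 : |Δ| * Y ≤ |Δ| * |(z * conj d).im| := by gcongr
    linarith

/-- The modulus of each exponential is at most `exp (B |Re τ| - Y Im τ)`. Applied to the
perturbation `h` and to its derivative. -/
lemma eventually_norm_sum_exp_le {ι : Type*} (T : Finset ι) (c τ : ι → ℂ)
    (hτ : ∀ i ∈ T, 0 < (τ i).im) (B : ℝ) {ε : ℝ} (hε : 0 < ε) :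
    ∀ᶠ Y : ℝ in atTop, ∀ ζ ∈ halfStrip B Y,
      ‖∑ i ∈ T, c i * Complex.exp (ζ * conj (τ i))‖ ≤ ε := by
  have h1 : Tendsto (fun Y : ℝ => ∑ i ∈ T, ‖c i‖ * Real.exp (B * |(τ i).re| - Y * (τ i).im))
      atTop (𝓝 0) := by
    rw [← Finset.sum_const_zero (s := T)]
    refine tendsto_finsetSum _ fun i hi => ?_
    have h2 : Tendsto (fun Y : ℝ => B * |(τ i).re| - Y * (τ i).im) atTop atBot := by
      have := (tendsto_id.atTop_mul_const (hτ i hi)).const_mul_atTop_of_neg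
        (show (-1 : ℝ) < 0 by norm_num)
      refine (tendsto_atBot_add_const_left _ (B * |(τ i).re|) this).congr fun Y => ?_
      simp; ring
    simpa using (Real.tendsto_exp_atBot.comp h2).const_mul ‖c i‖
  filter_upwards [h1.eventually_le_const hε] with Y hY ζ hζ
  refine (norm_sum_le _ _).trans (le_trans (Finset.sum_le_sum fun i hi => ?_) hY)
  rw [norm_mul, Complex.norm_exp]
  refine mul_le_mul_of_nonneg_left (Real.exp_le_exp.2 ?_) (norm_nonneg _)
  have h2 : (ζ * conj (τ i)).re = ζ.re * (τ i).re + ζ.im * (τ i).im := by simp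
  have h3 : ζ.re * (τ i).re ≤ B * |(τ i).re| := by
    refine (le_abs_self _).trans ?_
    rw [abs_mul]
    exact mul_le_mul_of_nonneg_right hζ.1 (abs_nonneg _)
  have h4 : ζ.im * (τ i).im ≤ -Y * (τ i).im := mul_le_mul_of_nonneg_right hζ.2 (hτ i hi).le
  rw [h2]; linarith

/-- The zeros of an exponential sum in the half-strip that belongs to an edge. -/
def edgeZeros (S : Finset ℂ) (δ : ℂ → ℂ) (B Y : ℝ) (e : ℂ × ℂ) : Set ℂ :=
  {z | expSum S δ z = 0 ∧ z * conj (e.2 - e.1) ∈ halfStrip B Y}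

lemma GenericSum.eventually_edgeZeros (hg : GenericSum S δ) {e : ℂ × ℂ}
    (he : e ∈ edges (convexHull ℝ (S : Set ℂ))) {B : ℝ} (hB : ‖edgeShift δ e‖ + 1 ≤ B) :
    ∀ᶠ Y : ℝ in atTop, (∀ z ∈ edgeZeros S δ B Y e, deriv (expSum S δ) z ≠ 0) ∧
      ∃ C : ℝ, ∀ E : ℝ, 0 ≤ E → (edgeZeros S δ B Y e ∩ {z | ‖z‖ ≤ E}).Finite ∧
        |((edgeZeros S δ B Y e ∩ {z | ‖z‖ ≤ E}).ncard : ℝ) -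
          E / (2 * Real.pi) * dist e.1 e.2| ≤ C := by
  obtain ⟨ν, hν, hs⟩ := exists_isSide_of_mem_edges he
  have hp : 0 < dist e.1 e.2 := dist_pos.2 he.2.2.1
  have hδ1 : δ e.1 ≠ 0 := hg.1 _ he.1
  have hδ2 : δ e.2 ≠ 0 := hg.1 _ he.2.1
  set d := e.2 - e.1 with hd
  have hn : ‖d‖ = dist e.1 e.2 := by rw [dist_comm, dist_eq_norm]
  have hd0 : d ≠ 0 := norm_ne_zero_iff.1 (by rw [hn]; exact hp.ne')
  have hcd0 : conj d ≠ 0 := (map_ne_zero _).2 hd0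
  set T := (S.erase e.1).erase e.2 with hT
  -- Chosen so that `z conj (w - e.1) = ζ conj (τ w)` for `ζ = z conj d`; `Im τ w > 0` says that `w`
  -- lies strictly to the left of the edge.
  set τ : ℂ → ℂ := fun w => (w - e.1) / d with hτd
  have hτ : ∀ w ∈ T, 0 < (τ w).im := by
    intro w hw
    rw [hT, Finset.mem_erase, Finset.mem_erase] at hw
    have hlt := hg.re_lt hν hs hw.2.2 hw.2.1 hw.1
    have h1 : τ w = conj d * (w - e.1) / ((‖d‖ ^ 2 : ℝ) : ℂ) := by
      have : ((‖d‖ ^ 2 : ℝ) : ℂ) = d * conj d := by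
        rw [Complex.mul_conj, Complex.normSq_eq_norm_sq]
      rw [this, hτd]
      simp only
      field_simp
    rw [h1, Complex.div_ofReal_im, hs.conj_sub_mul_im hν]
    have : 0 < ‖d‖ := norm_pos_iff.2 hd0
    exact div_pos (mul_pos hp (sub_pos.2 hlt)) (by positivity)
  set c : ℂ := δ e.2 / δ e.1 with hc
  have hc0 : c ≠ 0 := div_ne_zero hδ2 hδ1
  set h : ℂ → ℂ := fun ζ => ∑ w ∈ T, δ w / δ e.1 * Complex.exp (ζ * conj (τ w)) with hh
  have hhd : ∀ ζ, HasDerivAt h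
      (∑ w ∈ T, (δ w / δ e.1 * conj (τ w)) * Complex.exp (ζ * conj (τ w))) ζ := by
    intro ζ
    refine HasDerivAt.fun_sum fun w _ => ?_
    refine ((((hasDerivAt_id ζ).mul_const (conj (τ w))).cexp).const_mul (δ w / δ e.1)).congr_deriv ?_
    simp; ring
  have hhdiff : Differentiable ℂ h := fun ζ => (hhd ζ).differentiableAt
  have hm1 : e.1 ∈ S := extremePoints_convexHull_subset he.1
  have hm2 : e.2 ∈ S.erase e.1 :=
    Finset.mem_erase.2 ⟨he.2.2.1.symm, extremePoints_convexHull_subset he.2.1⟩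
  have hF : ∀ z, expSum S δ z = δ e.1 * Complex.exp (z * conj e.1) *
      (1 + c * Complex.exp (z * conj d) + h (z * conj d)) := by
    intro z
    rw [expSum_eq S δ e.1, ← Finset.add_sum_erase _ _ hm1, ← Finset.add_sum_erase _ _ hm2, hh, hc]
    simp only [sub_self, map_zero, mul_zero, Complex.exp_zero, mul_one]
    have : ∀ w ∈ T, δ w * Complex.exp (z * conj (w - e.1)) =
        δ e.1 * (δ w / δ e.1 * Complex.exp (z * conj d * conj (τ w))) := by
      intro w _
      have h1 : z * conj d * conj (τ w) = z * conj (w - e.1) := by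
        rw [hτd]; simp only [map_div₀]; field_simp
      rw [h1]; field_simp
    rw [Finset.sum_congr rfl this, ← Finset.mul_sum, ← hd]
    field_simp
    ring
  have hF0 : ∀ z, expSum S δ z = 0 ↔
      1 + c * Complex.exp (z * conj d) + h (z * conj d) = 0 := by
    intro z
    rw [hF z]
    simp [hδ1, Complex.exp_ne_zero]
  have hsmall : ∀ᶠ Y : ℝ in atTop, ∀ ζ ∈ halfStrip B Y, ‖h ζ‖ ≤ 1 / 4 ∧ ‖deriv h ζ‖ ≤ 1 / 4 := by
    filter_upwards [eventually_norm_sum_exp_le T (fun w => δ w / δ e.1) τ hτ B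
      (show (0 : ℝ) < 1 / 4 by norm_num), eventually_norm_sum_exp_le T
      (fun w => δ w / δ e.1 * conj (τ w)) τ hτ B (show (0 : ℝ) < 1 / 4 by norm_num)]
      with Y h1 h2 ζ hζ
    refine ⟨h1 ζ hζ, ?_⟩
    rw [(hhd ζ).deriv]
    exact h2 ζ hζ
  filter_upwards [hsmall, eventually_gt_atTop (‖edgeShift δ e‖ + 1)] with Y hY hYB
  constructor
  -- At a zero the product rule leaves only the non-vanishing prefactor times the derivative of the
  -- bracket.
  · rintro z ⟨hz, hzs⟩
    have h0 := (hF0 z).1 hz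
    have h1 := deriv_ne_zero_of_mem_stripZeros hY (ζ := z * conj d) (c := c) ⟨h0, hzs⟩
    have h2 : HasDerivAt (fun z => 1 + c * Complex.exp (z * conj d) + h (z * conj d))
        (conj d * (c * Complex.exp (z * conj d) + deriv h (z * conj d))) z := by
      have h3 : HasDerivAt (fun z => z * conj d) (conj d) z := by
        simpa using (hasDerivAt_id z).mul_const (conj d)
      have h4 := ((hhdiff (z * conj d)).hasDerivAt).comp z h3
      refine (((h3.cexp.const_mul c).const_add 1).add h4).congr_deriv ?_
      ring
    have h3 : HasDerivAt (fun z => δ e.1 * Complex.exp (z * conj e.1))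
        (δ e.1 * (Complex.exp (z * conj e.1) * conj e.1)) z := by
      have h3 : HasDerivAt (fun z => z * conj e.1) (conj e.1) z := by
        simpa using (hasDerivAt_id z).mul_const (conj e.1)
      exact h3.cexp.const_mul _
    have h4 := h3.mul h2
    have h5 : expSum S δ = (fun z => δ e.1 * Complex.exp (z * conj e.1)) *
        fun z => 1 + c * Complex.exp (z * conj d) + h (z * conj d) := funext hF
    rw [h5, h4.deriv, h0, mul_zero, zero_add]
    exact mul_ne_zero (mul_ne_zero hδ1 (Complex.exp_ne_zero _)) (mul_ne_zero hcd0 h1)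
  · obtain ⟨C, hC⟩ := exists_bound_ncard_stripZeros hc0 hhdiff hY hB hYB
    have hinj : Function.Injective fun z : ℂ => z * conj d := mul_left_injective₀ hcd0
    refine ⟨C, fun E hE => ?_⟩
    -- The substitution scales radii by the length of the edge, which produces the factor `dist e.1
    -- e.2` in the count.
    have himg : (fun z : ℂ => z * conj d) '' (edgeZeros S δ B Y e ∩ {z | ‖z‖ ≤ E}) =
        stripZeros c h B Y ∩ {ζ | ‖ζ‖ ≤ E * dist e.1 e.2} := by
      ext ζ
      constructor
      · rintro ⟨z, ⟨⟨hz, hzs⟩, hzE⟩, rfl⟩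
        refine ⟨⟨(hF0 z).1 hz, hzs⟩, ?_⟩
        change ‖z * conj d‖ ≤ _
        rw [norm_mul, Complex.norm_conj, hn]
        exact mul_le_mul_of_nonneg_right hzE hp.le
      · rintro ⟨⟨hz, hzs⟩, hzE⟩
        have hzd : ζ / conj d * conj d = ζ := div_mul_cancel₀ _ hcd0
        refine ⟨ζ / conj d, ⟨⟨?_, ?_⟩, ?_⟩, hzd⟩
        · rw [hF0, hzd]; exact hz
        · rw [← hd, hzd]; exact hzs
        · change ‖ζ / conj d‖ ≤ E
          rw [norm_div, Complex.norm_conj, hn, div_le_iff₀ hp]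
          exact hzE
    obtain ⟨h1, h2⟩ := hC (E * dist e.1 e.2) (by positivity)
    rw [← himg] at h1 h2
    rw [Set.ncard_image_of_injective _ hinj] at h2
    refine ⟨h1.of_finite_image hinj.injOn, ?_⟩
    rw [show E / (2 * Real.pi) * dist e.1 e.2 = E * dist e.1 e.2 / (2 * Real.pi) by ring]
    exact h2

/-- The number of zeros of a generic exponential sum in a disc. -/
theorem GenericSum.ncard_zeros (hg : GenericSum S δ) (hS : S.Nonempty) :
    (∃ R : ℝ, ∀ z, expSum S δ z = 0 → R ≤ ‖z‖ → deriv (expSum S δ) z ≠ 0) ∧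
    (∀ E : ℝ, {z | ‖z‖ ≤ E ∧ expSum S δ z = 0}.Finite) ∧
    ∃ C : ℝ, ∀ E : ℝ, 0 ≤ E → |({z | ‖z‖ ≤ E ∧ expSum S δ z = 0}.ncard : ℝ) -
      E / (2 * Real.pi) * perimeter (convexHull ℝ (S : Set ℂ))| ≤ C := by
  set 𝓔 := edges (convexHull ℝ (S : Set ℂ)) with h𝓔
  have hfin : 𝓔.Finite := finite_edges S.finite_toSet
  obtain ⟨B, hB⟩ : ∃ B : ℝ, ∀ e ∈ 𝓔, ‖edgeShift δ e‖ + 1 ≤ B :=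
    ((eventually_all_finite hfin).2 fun e _ => eventually_ge_atTop (‖edgeShift δ e‖ + 1)).exists
  obtain ⟨Y, hY1, hY2⟩ := (((eventually_all_finite hfin).2 fun e he =>
    hg.eventually_edgeZeros he (hB e he)).and ((eventually_all_finite hfin).2 fun e he =>
      (eventually_all_finite hfin).2 fun e' he' => show ∀ᶠ Y : ℝ in atTop, e ≠ e' →
        ∀ z : ℂ, z * conj (e.2 - e.1) ∈ halfStrip B Y →
          z * conj (e'.2 - e'.1) ∉ halfStrip B Y by
        by_cases hne : e = e'
        · exact Eventually.of_forall fun Y h => absurd hne h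
        · filter_upwards [eventually_not_mem_halfStrip he he' hne B] with Y h _ using h)).exists
  obtain ⟨R, hR⟩ := hg.exists_edge_of_zero hS hB Y
  have hsimple : ∀ z, expSum S δ z = 0 → R ≤ ‖z‖ → deriv (expSum S δ) z ≠ 0 := by
    intro z hz hzR
    obtain ⟨e, he, hze⟩ := hR z hz hzR
    exact (hY1 e he).1 z ⟨hz, hze⟩
  have hfinE : ∀ E : ℝ, {z | ‖z‖ ≤ E ∧ expSum S δ z = 0}.Finite := by
    intro E
    -- If the sum vanished identically, its zero at `|R|` would not be simple.
    obtain ⟨x, hx⟩ : ∃ x, expSum S δ x ≠ 0 := by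
      by_contra! h0
      have h1 : expSum S δ = fun _ => 0 := funext h0
      refine hsimple ((|R| : ℝ) : ℂ) (h0 _) ?_ (by rw [h1]; simp)
      simpa using le_abs_self R
    have hcod := AnalyticOnNhd.preimage_zero_mem_codiscrete (x := x)
      ((differentiable_expSum S δ).differentiableOn.analyticOnNhd isOpen_univ) hx
    have := (isCompact_closedBall (0 : ℂ) E).finite_sdiff_of_mem_codiscreteWithin
      (Filter.codiscreteWithin_mono (Set.subset_univ _) hcod)
    refine this.subset fun z hz => ⟨by simpa using hz.1, by simpa using hz.2⟩
  refine ⟨⟨R, hsimple⟩, hfinE, ?_⟩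
  choose! C hC using fun e he => (hY1 e he).2
  -- Zeros outside the half-strips lie in the disc of radius `R`; each edge adds its own error.
  refine ⟨({z | ‖z‖ ≤ R ∧ expSum S δ z = 0}.ncard : ℝ) + ∑ e ∈ hfin.toFinset, C e,
    fun E hE => ?_⟩
  set A : ℂ × ℂ → Set ℂ := fun e => edgeZeros S δ B Y e ∩ {z | ‖z‖ ≤ E} with hA
  have hcard : (⋃ e ∈ 𝓔, A e).ncard = ∑ e ∈ hfin.toFinset, (A e).ncard := by
    rw [hfin.ncard_biUnion (fun e he => (hC e he E hE).1), finsum_mem_eq_finite_toFinset_sum _ hfin]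
    intro e he e' he' hne
    rw [Function.onFun, Set.disjoint_left]
    intro z hz hz'
    exact hY2 e he e' he' hne z hz.1.2 hz'.1.2
  have hsub1 : (⋃ e ∈ 𝓔, A e) ⊆ {z | ‖z‖ ≤ E ∧ expSum S δ z = 0} := by
    intro z hz
    simp only [Set.mem_iUnion] at hz
    obtain ⟨e, he, hz⟩ := hz
    exact ⟨hz.2, hz.1.1⟩
  have hsub2 : {z | ‖z‖ ≤ E ∧ expSum S δ z = 0} ⊆
      {z | ‖z‖ ≤ R ∧ expSum S δ z = 0} ∪ ⋃ e ∈ 𝓔, A e := by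
    rintro z ⟨hzE, hz⟩
    rcases le_total ‖z‖ R with h | h
    · exact Or.inl ⟨h, hz⟩
    · obtain ⟨e, he, hze⟩ := hR z hz h
      exact Or.inr (Set.mem_biUnion he ⟨⟨hz, hze⟩, hzE⟩)
  have hle1 := Set.ncard_le_ncard hsub1 (hfinE E)
  have hle2 := (Set.ncard_le_ncard hsub2 ((hfinE R).union ((hfinE E).subset hsub1))).trans
    (Set.ncard_union_le _ _)
  rw [hcard] at hle1 hle2
  have hle1' : ∑ e ∈ hfin.toFinset, ((A e).ncard : ℝ) ≤
      {z | ‖z‖ ≤ E ∧ expSum S δ z = 0}.ncard := by exact_mod_cast hle1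
  have hle2' : ({z | ‖z‖ ≤ E ∧ expSum S δ z = 0}.ncard : ℝ) ≤
      {z | ‖z‖ ≤ R ∧ expSum S δ z = 0}.ncard + ∑ e ∈ hfin.toFinset, ((A e).ncard : ℝ) := by
    exact_mod_cast hle2
  have hsum : |∑ e ∈ hfin.toFinset, ((A e).ncard : ℝ) -
      E / (2 * Real.pi) * perimeter (convexHull ℝ (S : Set ℂ))| ≤ ∑ e ∈ hfin.toFinset, C e := by
    rw [perimeter, finsum_mem_eq_finite_toFinset_sum _ hfin, Finset.mul_sum,
      ← Finset.sum_sub_distrib]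
    refine (Finset.abs_sum_le_sum_abs _ _).trans (Finset.sum_le_sum fun e he => ?_)
    exact (hC e (hfin.mem_toFinset.1 he) E hE).2
  rw [abs_le] at hsum ⊢
  have : (0 : ℝ) ≤ {z | ‖z‖ ≤ R ∧ expSum S δ z = 0}.ncard := Nat.cast_nonneg _
  constructor <;> linarith

end ExpSum

end EllipticSystem

namespace EllipticSystem

open scoped ComplexConjugate

/-! ### Ordered matrix products -/

section DescProd

variable {n m : ℕ}

lemma descProd_zero (M : Fin 0 → Matrix (Fin n) (Fin n) ℂ) : descProd M = 1 := by
  simp [descProd]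

lemma descProd_succ (M : Fin (m + 1) → Matrix (Fin n) (Fin n) ℂ) :
    descProd M = descProd (fun s => M s.succ) * M 0 := by
  simp [descProd, List.ofFn_succ]

lemma descProd_succ' (M : Fin (m + 1) → Matrix (Fin n) (Fin n) ℂ) :
    descProd M = M (Fin.last m) * descProd fun s => M s.castSucc := by
  rw [descProd, List.ofFn_succ', List.concat_eq_append, List.reverse_append, List.prod_append]
  simp [descProd]

lemma descProd_sum {ι : Type*} [Fintype ι] (N : Fin m → ι → Matrix (Fin n) (Fin n) ℂ) :
    descProd (fun s => ∑ j, N s j) = ∑ t : Fin m → ι, descProd fun s => N s (t s) := by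
  induction m with
  | zero => simp [descProd_zero]
  | succ m ih =>
    rw [descProd_succ, ih, ← (Fin.consEquiv fun _ => ι).sum_comp, Fintype.sum_prod_type_right,
      Finset.sum_mul]
    refine Finset.sum_congr rfl fun t _ => ?_
    rw [Finset.mul_sum]
    refine Finset.sum_congr rfl fun j _ => ?_
    rw [descProd_succ]
    simp [Fin.consEquiv]

lemma descProd_smul (c : Fin m → ℂ) (M : Fin m → Matrix (Fin n) (Fin n) ℂ) :
    descProd (fun s => c s • M s) = (∏ s, c s) • descProd M := by
  induction m with
  | zero => simp [descProd_zero]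
  | succ m ih =>
    rw [descProd_succ, ih, descProd_succ M, Fin.prod_univ_succ]
    rw [smul_mul_smul_comm, mul_comm]

lemma descProd_one : descProd (fun _ : Fin m => (1 : Matrix (Fin n) (Fin n) ℂ)) = 1 := by
  simp [descProd]

/-- The factors to the left of position `s` are `1`, so the `s`-th factor can be pulled out and
replaced by `1`. -/
lemma descProd_eq_mul (s : Fin m) {U U' : Fin m → Matrix (Fin n) (Fin n) ℂ}
    (h1 : ∀ r, s < r → U r = 1) (h2 : ∀ r, r ≠ s → U' r = U r) (h3 : U' s = 1) :
    descProd U = U s * descProd U' := by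
  induction m with
  | zero => exact s.elim0
  | succ m ih =>
    rw [descProd_succ' U, descProd_succ' U']
    induction s using Fin.lastCases with
    | last =>
      rw [h3, one_mul]
      congr 2
      funext r
      exact (h2 _ (Fin.castSucc_lt_last r).ne).symm
    | cast s =>
      rw [h2 _ (Fin.castSucc_lt_last s).ne', h1 _ (Fin.castSucc_lt_last s), one_mul, one_mul]
      exact ih s (fun r hr => h1 _ (Fin.castSucc_lt_castSucc_iff.2 hr))
        (fun r hr => h2 _ fun h => hr (Fin.castSucc_injective _ h)) h3

lemma eq_descProd_mulVec (U : Fin m → Matrix (Fin n) (Fin n) ℂ) (y : Fin (m + 1) → Fin n → ℂ)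
    (hy : ∀ s : Fin m, y s.succ = U s *ᵥ y s.castSucc) :
    y (Fin.last m) = descProd U *ᵥ y 0 := by
  induction m with
  | zero => simp [descProd_zero]
  | succ m ih =>
    rw [descProd_succ', ← Matrix.mulVec_mulVec, ← Fin.succ_last, hy]
    congr 1
    exact ih (fun s => U s.castSucc) (fun s => y s.castSucc) fun s => hy s.castSucc

lemma continuous_descProd {X : Type*} [TopologicalSpace X]
    {U : X → Fin m → Matrix (Fin n) (Fin n) ℂ} (hU : ∀ s, Continuous fun x => U x s) :
    Continuous fun x => descProd (U x) := by
  induction m with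
  | zero => simp only [descProd_zero]; exact continuous_const
  | succ m ih =>
    simp only [descProd_succ]
    exact (ih fun s => hU s.succ).matrix_mul (hU 0)

end DescProd

/-! ### The characteristic function as an exponential sum -/

section CharFun

variable {n m : ℕ} {p : Fin (m + 1) → ℝ} {M : Fin m → Matrix (Fin n) (Fin n) ℂ}
  {V : Fin m → Matrix (Fin n) (Fin n) ℂ} {a : Fin m → Fin n → ℂ} {u v : Fin n → ℂ}

lemma inv_conj_diagonal {V M : Matrix (Fin n) (Fin n) ℂ} {a : Fin n → ℂ} (hV : IsUnit V)
    (ha : ∀ i, a i ≠ 0) (hM : M = V * Matrix.diagonal a * V⁻¹) :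
    M⁻¹ = V * Matrix.diagonal (fun i => (a i)⁻¹) * V⁻¹ := by
  have hdet : IsUnit V.det := (Matrix.isUnit_iff_isUnit_det V).1 hV
  apply Matrix.inv_eq_right_inv
  have h1 : Matrix.diagonal a * Matrix.diagonal (fun i => (a i)⁻¹) = 1 := by
    rw [Matrix.diagonal_mul_diagonal, ← Matrix.diagonal_one]
    congr 1
    funext i
    exact mul_inv_cancel₀ (ha i)
  calc M * (V * Matrix.diagonal (fun i => (a i)⁻¹) * V⁻¹)
      = V * (Matrix.diagonal a * (V⁻¹ * V) * Matrix.diagonal (fun i => (a i)⁻¹)) * V⁻¹ := by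
        rw [hM]; simp only [Matrix.mul_assoc]
    _ = 1 := by
        rw [Matrix.nonsing_inv_mul V hdet, Matrix.mul_one, h1, Matrix.mul_one,
          Matrix.mul_nonsing_inv V hdet]

lemma isUnit_of_conj_diagonal {V M : Matrix (Fin n) (Fin n) ℂ} {a : Fin n → ℂ} (hV : IsUnit V)
    (ha : ∀ i, a i ≠ 0) (hM : M = V * Matrix.diagonal a * V⁻¹) : IsUnit M.det := by
  have hdet : IsUnit V.det := (Matrix.isUnit_iff_isUnit_det V).1 hV
  rw [hM, Matrix.det_mul, Matrix.det_mul, Matrix.det_diagonal]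
  refine (hdet.mul ?_).mul ((Matrix.isUnit_nonsing_inv_det_iff).2 hdet)
  exact isUnit_iff_ne_zero.2 (Finset.prod_ne_zero_iff.2 fun i _ => ha i)

/-- Spectral decomposition: the exponential acts as a scalar on the range of each projection `V P_j
V⁻¹`. -/
lemma exp_smul_inv {V M : Matrix (Fin n) (Fin n) ℂ} {a : Fin n → ℂ} (hV : IsUnit V)
    (ha : ∀ i, a i ≠ 0) (hM : M = V * Matrix.diagonal a * V⁻¹) (z : ℂ) :
    NormedSpace.exp (z • M⁻¹) =
      ∑ j, Complex.exp (z * (a j)⁻¹) • (V * Matrix.single j j 1 * V⁻¹) := by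
  have h1 : z • M⁻¹ = V * Matrix.diagonal (fun i => z * (a i)⁻¹) * V⁻¹ := by
    rw [inv_conj_diagonal hV ha hM, ← Matrix.smul_mul, ← Matrix.mul_smul, ← Matrix.diagonal_smul]
    rfl
  rw [h1, Matrix.exp_conj _ _ hV, Matrix.exp_diagonal]
  have h2 : (Matrix.diagonal (NormedSpace.exp fun i => z * (a i)⁻¹) : Matrix (Fin n) (Fin n) ℂ) =
      ∑ j, Complex.exp (z * (a j)⁻¹) • Matrix.single j j 1 := by
    ext i k
    rw [Matrix.sum_apply, Matrix.diagonal_apply, Pi.coe_exp, ← Complex.exp_eq_exp_ℂ]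
    simp only [Matrix.smul_apply, Matrix.single_apply, smul_eq_mul, mul_ite, mul_one, mul_zero]
    by_cases h : i = k
    · subst h; simp
    · rw [if_neg h]
      symm
      refine Finset.sum_eq_zero fun j _ => if_neg ?_
      rintro ⟨rfl, rfl⟩
      exact h rfl
  rw [h2, Finset.mul_sum, Finset.sum_mul]
  refine Finset.sum_congr rfl fun j _ => ?_
  rw [Matrix.mul_smul, Matrix.smul_mul]

/-- The characteristic function is an exponential sum. -/
lemma charFun_eq_expSum (hV : ∀ s, IsUnit (V s)) (ha : ∀ s i, a s i ≠ 0)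
    (hM : ∀ s, M s = V s * Matrix.diagonal (a s) * (V s)⁻¹) :
    charFun p M u v = expSum (Finset.univ.image (gam p a)) (delta p a V u v) := by
  funext z
  have h1 : transfer p M z = ∑ t : Fin m → Fin n, Complex.exp (z * conj (gam p a t)) •
      descProd fun s => V s * Matrix.single (t s) (t s) 1 * (V s)⁻¹ := by
    rw [transfer]
    simp only [fun s => exp_smul_inv (hV s) (ha s) (hM s)]
    rw [descProd_sum]
    refine Finset.sum_congr rfl fun t _ => ?_
    rw [descProd_smul, ← Complex.exp_sum]
    congr 2
    rw [gam, Complex.conj_conj, Finset.mul_sum]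
    exact Finset.sum_congr rfl fun s _ => by ring
  rw [charFun, h1, Matrix.sum_mulVec, sum_dotProduct, expSum]
  rw [← Finset.sum_fiberwise_of_maps_to (g := gam p a) (t := Finset.univ.image (gam p a))
    fun t _ => Finset.mem_image_of_mem _ (Finset.mem_univ t)]
  refine Finset.sum_congr rfl fun w _ => ?_
  rw [delta, Finset.sum_mul]
  refine Finset.sum_congr rfl fun t ht => ?_
  rw [(Finset.mem_filter.1 ht).2, Matrix.smul_mulVec, smul_dotProduct, smul_eq_mul, mul_comm]

lemma Generic.genericSum (hgen : Generic p a V u v) :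
    GenericSum (Finset.univ.image (gam p a)) (delta p a V u v) := by
  have h : ((Finset.univ.image (gam p a) : Finset ℂ) : Set ℂ) = Set.range (gam p a) := by simp
  rw [GenericSum, h]
  refine ⟨hgen.1, fun e he w hw => ?_⟩
  obtain ⟨t, -, rfl⟩ := Finset.mem_image.1 hw
  exact hgen.2 e he t

end CharFun

end EllipticSystem

namespace EllipticSystem

open scoped Topology

/-! ### Solutions of the system with constant coefficients -/

section Flow

variable {n : ℕ}

lemma continuous_exp_smul (N : Matrix (Fin n) (Fin n) ℂ) :
    Continuous fun t : ℝ => NormedSpace.exp (t • N) := by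
  open scoped Matrix.Norms.Operator in
  exact NormedSpace.exp_continuous.comp (continuous_id.smul continuous_const)

lemma hasDerivAt_exp_smul_mulVec (N : Matrix (Fin n) (Fin n) ℂ) (c : Fin n → ℂ) (t : ℝ) :
    HasDerivAt (fun t : ℝ => NormedSpace.exp (t • N) *ᵥ c)
      (N *ᵥ (NormedSpace.exp (t • N) *ᵥ c)) t := by
  open scoped Matrix.Norms.Operator in
  let L : Matrix (Fin n) (Fin n) ℂ →ₗ[ℝ] (Fin n → ℂ) :=
    { toFun := fun X => X *ᵥ c
      map_add' := fun X Y => Matrix.add_mulVec X Y c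
      map_smul' := fun r X => Matrix.smul_mulVec r X c }
  have h1 := L.toContinuousLinearMap.hasFDerivAt.comp_hasDerivAt t
    (hasDerivAt_exp_smul_const' (𝕂 := ℝ) N t)
  refine h1.congr_deriv ?_
  change (N * NormedSpace.exp (t • N)) *ᵥ c = _
  rw [Matrix.mulVec_mulVec]

lemma hasDerivAt_exp_sub_smul_mulVec (N : Matrix (Fin n) (Fin n) ℂ) (c : Fin n → ℂ) (t q : ℝ) :
    HasDerivAt (fun t : ℝ => NormedSpace.exp ((t - q) • N) *ᵥ c)
      (N *ᵥ (NormedSpace.exp ((t - q) • N) *ᵥ c)) t := by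
  simpa using (hasDerivAt_exp_smul_mulVec N c (t - q)).comp_sub_const t q

lemma continuous_mulVec_const (N : Matrix (Fin n) (Fin n) ℂ) :
    Continuous fun c : Fin n → ℂ => N *ᵥ c :=
  continuous_const.matrix_mulVec continuous_id

/-- The continuous solutions of `f' = N f` are `exp (t N) c`. -/
lemma eq_exp_mulVec_of_integral_eq {N : Matrix (Fin n) (Fin n) ℂ} {f : ℝ → Fin n → ℂ} {q r : ℝ}
    (hqr : q ≤ r) (hf : ContinuousOn f (Set.Icc q r))
    (heq : ∀ x ∈ Set.Icc q r, f x = f q + ∫ t in q..x, N *ᵥ f t) {x : ℝ}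
    (hx : x ∈ Set.Icc q r) : f x = NormedSpace.exp ((x - q) • N) *ᵥ f q := by
  -- The constant extension makes the integrand continuous on the whole line, so its primitive is
  -- differentiable also at the end points and the uniqueness theorem for ODEs applies.
  set g := Set.IccExtend hqr ((Set.Icc q r).domRestrict f) with hg
  have hgc : Continuous g := (continuousOn_iff_continuous_domRestrict.1 hf).Icc_extend'
  have hgf : ∀ x ∈ Set.Icc q r, g x = f x := fun x hx => Set.IccExtend_of_mem _ _ hx
  set G : ℝ → Fin n → ℂ := fun x => f q + ∫ t in q..x, N *ᵥ g t with hG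
  have hGd : ∀ x, HasDerivAt G (N *ᵥ g x) x := by
    intro x
    exact (((continuous_mulVec_const N).comp hgc).integral_hasStrictDerivAt q
      x).hasDerivAt.const_add (f q)
  have hGf : ∀ x ∈ Set.Icc q r, G x = f x := by
    intro x hx
    rw [heq x hx]
    refine congrArg (f q + ·) (intervalIntegral.integral_congr fun t ht => ?_)
    rw [Set.uIcc_of_le hx.1] at ht
    exact congrArg (N *ᵥ ·) (hgf t ⟨ht.1, ht.2.trans hx.2⟩)
  let L : (Fin n → ℂ) →L[ℝ] (Fin n → ℂ) :=
    ((Matrix.mulVecLin N).restrictScalars ℝ).toContinuousLinearMap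
  have huniq := ODE_solution_unique (v := fun _ y => N *ᵥ y) (K := ‖L‖₊) (a := q) (b := r)
    (f := G) (g := fun t => NormedSpace.exp ((t - q) • N) *ᵥ f q)
    (fun _ => L.lipschitz) (fun t _ => (hGd t).continuousAt.continuousWithinAt)
    (fun t ht => by
      have h1 : t ∈ Set.Icc q r := ⟨ht.1, ht.2.le⟩
      rw [hGf t h1, ← hgf t h1]
      exact (hGd t).hasDerivWithinAt)
    (fun t _ => (hasDerivAt_exp_sub_smul_mulVec N _ t q).continuousAt.continuousWithinAt)
    (fun t _ => (hasDerivAt_exp_sub_smul_mulVec N _ t q).hasDerivWithinAt)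
    (by simp [hG, NormedSpace.exp_zero])
  rw [← hGf x hx]
  exact huniq hx

end Flow

/-! ### Partitions and the propagator -/

section Partition

variable {m : ℕ} {p : Fin (m + 1) → ℝ}

lemma exists_mem_Ioc_partition {x : ℝ} (hx : x ∈ Set.Ioc (p 0) (p (Fin.last m))) :
    ∃ s : Fin m, x ∈ Set.Ioc (p s.castSucc) (p s.succ) := by
  by_contra! h
  have : ∀ s, p s < x := by
    intro s
    induction s using Fin.induction with
    | zero => exact hx.1
    | succ s ih => exact lt_of_not_ge fun h' => h s ⟨ih, h'⟩
  exact absurd hx.2 (not_le.2 (this _))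

lemma len_pos (hp : StrictMono p) (s : Fin m) : 0 < len p s :=
  sub_pos.2 (hp (Fin.castSucc_lt_succ))

lemma succ_le_castSucc (hp : StrictMono p) {r s : Fin m} (h : r < s) :
    p r.succ ≤ p s.castSucc :=
  hp.monotone (Fin.succ_le_castSucc_iff.2 h)

lemma Icc_partition_subset (hp : StrictMono p) (s : Fin m) :
    Set.Icc (p s.castSucc) (p s.succ) ⊆ Set.Icc (p 0) (p (Fin.last m)) :=
  Set.Icc_subset_Icc (hp.monotone (Fin.zero_le _)) (hp.monotone (Fin.le_last _))

lemma eq_of_mem_Ioc_partition (hp : StrictMono p) {r s : Fin m} {x : ℝ}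
    (hr : x ∈ Set.Ioc (p r.castSucc) (p r.succ)) (hs : x ∈ Set.Ioc (p s.castSucc) (p s.succ)) :
    r = s := by
  rcases lt_trichotomy r s with h | h | h
  · exact absurd (hr.2.trans (succ_le_castSucc hp h)) (not_le.2 hs.1)
  · exact h
  · exact absurd (hs.2.trans (succ_le_castSucc hp h)) (not_le.2 hr.1)

end Partition

section Propagator

variable {n m : ℕ} {p : Fin (m + 1) → ℝ} {N : Fin m → Matrix (Fin n) (Fin n) ℂ}

/-- The part of `[p 0, x]` that lies in the `s`-th interval of a partition has length
`elapsed p s x`. -/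
noncomputable def elapsed (p : Fin (m + 1) → ℝ) (s : Fin m) (x : ℝ) : ℝ :=
  max 0 (min (x - p s.castSucc) (len p s))

lemma elapsed_of_le (hp : StrictMono p) {s : Fin m} {x : ℝ} (hx : x ≤ p s.castSucc) :
    elapsed p s x = 0 := by
  have := len_pos hp s
  rw [elapsed, min_eq_left (by linarith), max_eq_left (by linarith)]

lemma elapsed_of_ge (hp : StrictMono p) {s : Fin m} {x : ℝ} (hx : p s.succ ≤ x) :
    elapsed p s x = len p s := by
  rw [elapsed, min_eq_right (by rw [len]; linarith), max_eq_right (len_pos hp s).le]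

lemma elapsed_of_mem {s : Fin m} {x : ℝ} (hx : x ∈ Set.Icc (p s.castSucc) (p s.succ)) :
    elapsed p s x = x - p s.castSucc := by
  rw [elapsed, min_eq_left (by rw [len]; linarith [hx.2]), max_eq_right (by linarith [hx.1])]

/-- The matrix that maps `f (p 0)` to `f x` for the solutions of `f' = N s f` on the `s`-th
interval. -/
noncomputable def propagator (p : Fin (m + 1) → ℝ) (N : Fin m → Matrix (Fin n) (Fin n) ℂ)
    (x : ℝ) : Matrix (Fin n) (Fin n) ℂ :=
  descProd fun s => NormedSpace.exp (elapsed p s x • N s)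

lemma continuous_propagator : Continuous (propagator p N) := by
  refine continuous_descProd fun s => (continuous_exp_smul (N s)).comp ?_
  unfold elapsed
  fun_prop

lemma propagator_zero (hp : StrictMono p) : propagator p N (p 0) = 1 := by
  have : ∀ s : Fin m, elapsed p s (p 0) = 0 :=
    fun s => elapsed_of_le hp (hp.monotone (Fin.zero_le _))
  simp only [propagator, this, zero_smul, NormedSpace.exp_zero, descProd_one]

lemma propagator_last (hp : StrictMono p) :
    propagator p N (p (Fin.last m)) = descProd fun s => NormedSpace.exp (len p s • N s) := by
  have : ∀ s : Fin m, elapsed p s (p (Fin.last m)) = len p s :=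
    fun s => elapsed_of_ge hp (hp.monotone (Fin.le_last _))
  simp only [propagator, this]

/-- While `x` runs through the `s`-th interval, earlier factors are complete and later ones are
still `1`; only the `s`-th factor varies. -/
lemma propagator_of_mem (hp : StrictMono p) {s : Fin m} {x : ℝ}
    (hx : x ∈ Set.Icc (p s.castSucc) (p s.succ)) :
    propagator p N x =
      NormedSpace.exp ((x - p s.castSucc) • N s) * propagator p N (p s.castSucc) := by
  rw [propagator, descProd_eq_mul s (U' := fun r => NormedSpace.exp (elapsed p r (p s.castSucc) • N r)),
    elapsed_of_mem hx, propagator]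
  · intro r hr
    rw [elapsed_of_le hp (hx.2.trans (succ_le_castSucc hp hr)), zero_smul, NormedSpace.exp_zero]
  · intro r hr
    rcases lt_or_gt_of_ne hr with h | h
    · have h1 := succ_le_castSucc hp h
      simp only [elapsed_of_ge hp h1, elapsed_of_ge hp (h1.trans hx.1)]
    · have h1 := succ_le_castSucc hp h
      simp only [elapsed_of_le hp (hx.2.trans h1),
        elapsed_of_le hp (hp (Fin.castSucc_lt_castSucc_iff.2 h)).le]
  · simp only [elapsed_of_le hp le_rfl, zero_smul, NormedSpace.exp_zero]

lemma hasDerivAt_propagator_mulVec (hp : StrictMono p) (c : Fin n → ℂ) {s : Fin m} {x : ℝ}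
    (hx : x ∈ Set.Ioo (p s.castSucc) (p s.succ)) :
    HasDerivAt (fun x => propagator p N x *ᵥ c) (N s *ᵥ (propagator p N x *ᵥ c)) x := by
  have h := hasDerivAt_exp_sub_smul_mulVec (N s) (propagator p N (p s.castSucc) *ᵥ c) x
    (p s.castSucc)
  have heq : ∀ y ∈ Set.Icc (p s.castSucc) (p s.succ), propagator p N y *ᵥ c =
      NormedSpace.exp ((y - p s.castSucc) • N s) *ᵥ (propagator p N (p s.castSucc) *ᵥ c) := by
    intro y hy
    rw [propagator_of_mem hp hy, Matrix.mulVec_mulVec]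
  rw [heq x ⟨hx.1.le, hx.2.le⟩]
  refine h.congr_of_eventuallyEq ?_
  filter_upwards [Icc_mem_nhds hx.1 hx.2] with y hy using heq y hy

/-- The derivative of the solution with initial value `c`. -/
noncomputable def solutionDeriv (p : Fin (m + 1) → ℝ) (N : Fin m → Matrix (Fin n) (Fin n) ℂ)
    (c : Fin n → ℂ) (x : ℝ) : Fin n → ℂ :=
  ∑ s, (Set.Ioc (p s.castSucc) (p s.succ)).indicator
    (fun x => N s *ᵥ (propagator p N x *ᵥ c)) x

lemma solutionDeriv_of_mem (hp : StrictMono p) (c : Fin n → ℂ) {s : Fin m} {x : ℝ}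
    (hx : x ∈ Set.Ioc (p s.castSucc) (p s.succ)) :
    solutionDeriv p N c x = N s *ᵥ (propagator p N x *ᵥ c) := by
  rw [solutionDeriv, Finset.sum_eq_single s, Set.indicator_of_mem hx]
  · intro r _ hr
    exact Set.indicator_of_notMem (fun h => hr (eq_of_mem_Ioc_partition hp h hx)) _
  · intro h; exact absurd (Finset.mem_univ s) h

lemma memLp_solutionDeriv (c : Fin n → ℂ) (α β : ℝ) :
    MemLp (solutionDeriv p N c) 2 (volume.restrict (Set.Ioo α β)) := by
  refine memLp_finsetSum _ fun s _ => MemLp.indicator measurableSet_Ioc ?_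
  have hc : Continuous fun x => N s *ᵥ (propagator p N x *ᵥ c) :=
    (continuous_mulVec_const (N s)).comp (continuous_propagator.matrix_mulVec continuous_const)
  obtain ⟨C, hC⟩ := (isCompact_Icc (a := α) (b := β)).exists_bound_of_continuousOn hc.continuousOn
  refine MemLp.of_bound hc.aestronglyMeasurable C ?_
  filter_upwards [ae_restrict_mem measurableSet_Ioo] with x hx using hC x ⟨hx.1.le, hx.2.le⟩

lemma intervalIntegrable_of_memLp_two {α β : ℝ} (hαβ : α ≤ β) {g : ℝ → Fin n → ℂ}
    (hg : MemLp g 2 (volume.restrict (Set.Ioo α β))) : IntervalIntegrable g volume α β := by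
  rw [intervalIntegrable_iff_integrableOn_Ioo_of_le hαβ]
  exact hg.integrable (by norm_num)

lemma hasW12Deriv_propagator (hp : StrictMono p) (c : Fin n → ℂ) :
    HasW12Deriv (p 0) (p (Fin.last m)) (fun x => propagator p N x *ᵥ c)
      (solutionDeriv p N c) := by
  have hmem := memLp_solutionDeriv (p := p) (N := N) c (p 0) (p (Fin.last m))
  have hle : p 0 ≤ p (Fin.last m) := hp.monotone (Fin.zero_le _)
  refine ⟨hmem, fun x hx => ?_⟩
  have hint : IntervalIntegrable (solutionDeriv p N c) volume (p 0) x := by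
    refine (intervalIntegrable_of_memLp_two hle hmem).mono_set ?_
    rw [Set.uIcc_of_le hx.1, Set.uIcc_of_le hle]
    exact Set.Icc_subset_Icc_right hx.2
  have hderiv : ∀ y ∈ Set.Ioo (p 0) x \ Set.range p,
      HasDerivAt (fun x => propagator p N x *ᵥ c) (solutionDeriv p N c y) y := by
    intro y hy
    obtain ⟨s, hs⟩ := exists_mem_Ioc_partition (p := p) (x := y) ⟨hy.1.1, hy.1.2.le.trans hx.2⟩
    rw [solutionDeriv_of_mem hp c hs]
    exact hasDerivAt_propagator_mulVec hp c
      ⟨hs.1, lt_of_le_of_ne hs.2 fun h => hy.2 ⟨_, h.symm⟩⟩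
  -- The propagator is continuous and differentiable off the partition points, which suffices for
  -- the fundamental theorem of calculus.
  rw [integral_eq_of_hasDerivAt_off_countable_of_le _ _ hx.1
    (Set.countable_range p) (continuous_propagator.matrix_mulVec continuous_const).continuousOn
    hderiv hint]
  abel

end Propagator

/-! ### Eigenvalues and the characteristic function -/

section Eigenvalue

variable {n m : ℕ} {p : Fin (m + 1) → ℝ} {A : ℝ → Matrix (Fin n) (Fin n) ℂ}
  {M : Fin m → Matrix (Fin n) (Fin n) ℂ} {u v : Fin n → ℂ}

lemma transfer_eq_descProd (z : ℂ) :
    transfer p M z = descProd fun s => NormedSpace.exp (len p s • (z • (M s)⁻¹)) := by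
  rw [transfer]
  congr 1
  funext s
  congr 1
  rw [← Complex.coe_smul, smul_smul, mul_comm]

/-- On each interval of the partition, a solution of `A f' = z f` is an exponential. -/
lemma HasW12Deriv.eq_exp_mulVec (hp : StrictMono p) (hM : ∀ s, IsUnit (M s).det)
    (hA : ∀ s : Fin m, ∀ x ∈ Set.Ioc (p s.castSucc) (p s.succ), A x = M s) {z : ℂ}
    {f g : ℝ → Fin n → ℂ} (hfg : HasW12Deriv (p 0) (p (Fin.last m)) f g)
    (heq : ∀ᵐ x ∂(volume.restrict (Set.Ioo (p 0) (p (Fin.last m)))), A x *ᵥ g x = z • f x)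
    (s : Fin m) {x : ℝ} (hx : x ∈ Set.Icc (p s.castSucc) (p s.succ)) :
    f x = NormedSpace.exp ((x - p s.castSucc) • (z • (M s)⁻¹)) *ᵥ f (p s.castSucc) := by
  have hle : p 0 ≤ p (Fin.last m) := hp.monotone (Fin.zero_le _)
  have hint := intervalIntegrable_of_memLp_two hle hfg.1
  have hsub := Icc_partition_subset hp s
  have hsle : p s.castSucc ≤ p s.succ := (hp Fin.castSucc_lt_succ).le
  have hcont : ContinuousOn f (Set.Icc (p 0) (p (Fin.last m))) := by
    have h1 := intervalIntegral.continuousOn_primitive_interval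
      ((intervalIntegrable_iff' (by simp)).1 hint)
    rw [Set.uIcc_of_le hle] at h1
    exact (continuousOn_const.add h1).congr hfg.2
  refine eq_exp_mulVec_of_integral_eq hsle (hcont.mono hsub) (fun y hy => ?_) hx
  have hq := hsub (Set.left_mem_Icc.2 hsle)
  have hy' := hsub hy
  have hint' : ∀ y ∈ Set.Icc (p 0) (p (Fin.last m)), IntervalIntegrable g volume (p 0) y := by
    intro y hy
    refine hint.mono_set ?_
    rw [Set.uIcc_of_le hy.1, Set.uIcc_of_le hle]
    exact Set.Icc_subset_Icc_right hy.2
  have h1 : f y = f (p s.castSucc) + ∫ t in (p s.castSucc)..y, g t := by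
    rw [hfg.2 y hy', hfg.2 _ hq,
      ← intervalIntegral.integral_interval_sub_left (hint' y hy') (hint' _ hq)]
    abel
  rw [h1]
  congr 1
  refine intervalIntegral.integral_congr_ae ?_
  rw [restrict_Ioo_eq_restrict_Ioc, ae_restrict_iff' measurableSet_Ioc] at heq
  filter_upwards [heq] with t ht hty
  rw [Set.uIoc_of_le hy.1] at hty
  have hts : t ∈ Set.Ioc (p s.castSucc) (p s.succ) := ⟨hty.1, hty.2.trans hy.2⟩
  have h2 := ht ⟨hq.1.trans_lt hty.1, hty.2.trans hy'.2⟩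
  rw [hA s t hts] at h2
  -- Inverting `M s` in `M s g = z f` gives `g = z (M s)⁻¹ f` almost everywhere on the interval.
  rw [Matrix.smul_mulVec, ← Matrix.mulVec_smul, ← h2, Matrix.mulVec_mulVec,
    Matrix.nonsing_inv_mul _ (hM s), Matrix.one_mulVec]

/-- The eigenvalues of `L` are the zeros of the characteristic function. -/
theorem isEigenvalue_iff (hp : StrictMono p) (hM : ∀ s, IsUnit (M s).det)
    (hA : ∀ s : Fin m, ∀ x ∈ Set.Ioc (p s.castSucc) (p s.succ), A x = M s) (hu : u ≠ 0) (z : ℂ) :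
    IsEigenvalue (p 0) (p (Fin.last m)) A u v z ↔ charFun p M u v z = 0 := by
  have hle : p 0 ≤ p (Fin.last m) := hp.monotone (Fin.zero_le _)
  constructor
  · rintro ⟨f, g, hfg, hfu, hfv, ⟨x, hx, hfx⟩, heq⟩
    have hsol := fun s => @HasW12Deriv.eq_exp_mulVec n m p A M hp hM hA z f g hfg heq s
    have hstep : ∀ s : Fin m, f (p s.succ) =
        NormedSpace.exp (len p s • (z • (M s)⁻¹)) *ᵥ f (p s.castSucc) :=
      fun s => hsol s (Set.right_mem_Icc.2 (hp Fin.castSucc_lt_succ).le)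
    have hlast : f (p (Fin.last m)) = transfer p M z *ᵥ f (p 0) := by
      rw [transfer_eq_descProd]
      exact eq_descProd_mulVec _ (fun s => f (p s)) hstep
    obtain ⟨c, hc⟩ := Submodule.mem_span_singleton.1 hfu
    -- A zero initial value propagates through all partition points, so `f` would vanish
    -- identically.
    have hc0 : c ≠ 0 := by
      rintro rfl
      rw [zero_smul] at hc
      have hz : ∀ s, f (p s) = 0 := by
        intro s
        induction s using Fin.induction with
        | zero => exact hc.symm
        | succ s ih => rw [hstep, ih, Matrix.mulVec_zero]
      rcases hx.1.eq_or_lt with h | h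
      · exact hfx (h ▸ hc.symm)
      · obtain ⟨s, hs⟩ := exists_mem_Ioc_partition ⟨h, hx.2⟩
        exact hfx (by rw [hsol s ⟨hs.1.le, hs.2⟩, hz, Matrix.mulVec_zero])
    rw [hlast, ← hc, Matrix.mulVec_smul, smul_dotProduct, smul_eq_mul] at hfv
    exact (mul_eq_zero.1 hfv).resolve_left hc0
  · intro hz
    set N : Fin m → Matrix (Fin n) (Fin n) ℂ := fun s => z • (M s)⁻¹ with hN
    refine ⟨fun x => propagator p N x *ᵥ u, solutionDeriv p N u, hasW12Deriv_propagator hp u,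
      ?_, ?_, ⟨p 0, Set.left_mem_Icc.2 hle, ?_⟩, ?_⟩
    · simp only [propagator_zero hp, Matrix.one_mulVec]
      exact Submodule.mem_span_singleton_self u
    · simp only [propagator_last hp]
      rw [charFun, transfer_eq_descProd] at hz
      exact hz
    · simpa only [propagator_zero hp, Matrix.one_mulVec] using hu
    · filter_upwards [ae_restrict_mem measurableSet_Ioo] with x hx
      obtain ⟨s, hs⟩ := exists_mem_Ioc_partition (p := p) (x := x) ⟨hx.1, hx.2.le⟩
      rw [hA s x hs, solutionDeriv_of_mem hp u hs, hN]
      simp only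
      rw [Matrix.smul_mulVec, Matrix.mulVec_smul, Matrix.mulVec_mulVec,
        Matrix.mul_nonsing_inv _ (hM s), Matrix.one_mulVec]

end Eigenvalue

end EllipticSystem

namespace EllipticSystem

open scoped ComplexConjugate

/-! ### The integral of `b` as a perimeter -/

section Integral

variable {n m : ℕ} {p : Fin (m + 1) → ℝ} {A : ℝ → Matrix (Fin n) (Fin n) ℂ}
  {M : Fin m → Matrix (Fin n) (Fin n) ℂ} {V : Fin m → Matrix (Fin n) (Fin n) ℂ}
  {a : Fin m → Fin n → ℂ}

lemma spectrum_conj_diagonal {V D : Matrix (Fin n) (Fin n) ℂ} (hV : IsUnit V) :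
    spectrum ℂ (V * D * V⁻¹) = spectrum ℂ D := by
  obtain ⟨W, rfl⟩ := hV
  rw [← Matrix.coe_units_inv]
  exact spectrum.units_conjugate

lemma spectrum_inv {V M : Matrix (Fin n) (Fin n) ℂ} {a : Fin n → ℂ} (hV : IsUnit V)
    (ha : ∀ i, a i ≠ 0) (hM : M = V * Matrix.diagonal a * V⁻¹) :
    spectrum ℂ M⁻¹ = Set.range fun i => (a i)⁻¹ := by
  rw [inv_conj_diagonal hV ha hM, spectrum_conj_diagonal hV, spectrum_diagonal]

/-- The integral of a function that is constant on the intervals of a partition. -/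
lemma integral_partition (hp : StrictMono p) {f : ℝ → ℝ} {c : Fin m → ℝ}
    (hf : ∀ s : Fin m, ∀ x ∈ Set.Ioc (p s.castSucc) (p s.succ), f x = c s) :
    ∫ x in (p 0)..(p (Fin.last m)), f x = ∑ s, len p s * c s := by
  have hint : ∀ s : Fin m, IntervalIntegrable f volume (p s.castSucc) (p s.succ) := by
    intro s
    refine (intervalIntegrable_const (c := c s)).congr fun x hx => ?_
    rw [Set.uIoc_of_le (hp Fin.castSucc_lt_succ).le] at hx
    exact (hf s x hx).symm
  have hval : ∀ s : Fin m, ∫ x in (p s.castSucc)..(p s.succ), f x = len p s * c s := by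
    intro s
    rw [intervalIntegral.integral_congr_ae (g := fun _ => c s), intervalIntegral.integral_const,
      smul_eq_mul, len]
    refine ae_of_all _ fun x hx => ?_
    rw [Set.uIoc_of_le (hp Fin.castSucc_lt_succ).le] at hx
    exact hf s x hx
  have key : ∀ k : Fin (m + 1), IntervalIntegrable f volume (p 0) (p k) ∧
      ∫ x in (p 0)..(p k), f x = ∑ s with s.castSucc < k, len p s * c s := by
    intro k
    induction k using Fin.induction with
    | zero => simp
    | succ k ih =>
      refine ⟨ih.1.trans (hint k), ?_⟩
      rw [← intervalIntegral.integral_add_adjacent_intervals ih.1 (hint k), ih.2, hval]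
      have : (Finset.univ.filter fun s : Fin m => s.castSucc < k.succ) =
          insert k (Finset.univ.filter fun s : Fin m => s.castSucc < k.castSucc) := by
        ext s
        simp only [Finset.mem_filter, Finset.mem_univ, true_and, Finset.mem_insert,
          Fin.lt_def, Fin.val_castSucc, Fin.val_succ, Fin.ext_iff]
        omega
      rw [this, Finset.sum_insert (by simp), add_comm]
  rw [(key (Fin.last m)).2]
  simp [Fin.castSucc_lt_last]

/-- The integral of `b` is the perimeter of the convex hull of the points `γ`. -/
theorem integral_b (hn : 0 < n) (hp : StrictMono p)
    (hA : ∀ s : Fin m, ∀ x ∈ Set.Ioc (p s.castSucc) (p s.succ), A x = M s)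
    (hV : ∀ s, IsUnit (V s)) (ha : ∀ s i, a s i ≠ 0)
    (hM : ∀ s, M s = V s * Matrix.diagonal (a s) * (V s)⁻¹) :
    ∫ x in (p 0)..(p (Fin.last m)), b A x =
      perimeter (convexHull ℝ (Set.range (gam p a))) := by
  have : Nonempty (Fin n) := ⟨⟨0, hn⟩⟩
  have h1 : Set.range (gam p a) = conj '' Set.range fun t : Fin m → Fin n =>
      ∑ s, (fun s i => (a s i)⁻¹) s (t s) * (len p s : ℂ) := by
    rw [← Set.range_comp]; rfl
  rw [h1, perimeter_image_conj (Set.finite_range _) (Set.range_nonempty _),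
    perimeter_sum (f := fun s i => (a s i)⁻¹) hn (len_pos hp)]
  refine integral_partition hp fun s x hx => ?_
  rw [b, hA s x hx, spectrum_inv (hV s) (ha s) (hM s)]

end Integral

/-! ### Multiplicities and the final estimate -/

section Multiplicity

/-- Simple zeros contribute equally to both counts, so the difference is bounded by a sum over the
finitely many zeros in the disc of radius `R`, whatever `E` is. -/
lemma zeroCount_sub_ncard_le {F : ℂ → ℂ} (hF : Differentiable ℂ F) {R : ℝ}
    (hR : ∀ z, F z = 0 → R ≤ ‖z‖ → deriv F z ≠ 0)
    (hfin : ∀ E : ℝ, {z | ‖z‖ ≤ E ∧ F z = 0}.Finite) :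
    ∃ C : ℝ, ∀ E : ℝ,
      |(zeroCount F E : ℝ) - ({z | ‖z‖ ≤ E ∧ F z = 0}.ncard : ℝ)| ≤ C := by
  refine ⟨∑ z ∈ (hfin R).toFinset, |(analyticOrderNatAt F z : ℝ) - 1|, fun E => ?_⟩
  have h1 : (zeroCount F E : ℝ) - ({z | ‖z‖ ≤ E ∧ F z = 0}.ncard : ℝ) =
      ∑ z ∈ (hfin E).toFinset, ((analyticOrderNatAt F z : ℝ) - 1) := by
    rw [zeroCount, finsum_mem_eq_finite_toFinset_sum _ (hfin E),
      Set.ncard_eq_toFinset_card _ (hfin E), Finset.sum_sub_distrib]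
    simp
  rw [h1]
  refine (Finset.abs_sum_le_sum_abs _ _).trans ?_
  rw [← Finset.sum_filter_add_sum_filter_not _ (fun z => ‖z‖ ≤ R)]
  have h2 : ∑ z ∈ (hfin E).toFinset with ¬ ‖z‖ ≤ R, |(analyticOrderNatAt F z : ℝ) - 1| = 0 := by
    refine Finset.sum_eq_zero fun z hz => ?_
    rw [Finset.mem_filter, Set.Finite.mem_toFinset] at hz
    have := (hF.analyticAt z).analyticOrderAt_eq_one_of_zero_deriv_ne_zero hz.1.2
      (hR z hz.1.2 (not_le.1 hz.2).le)
    simp [analyticOrderNatAt, this]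
  rw [h2, add_zero]
  refine Finset.sum_le_sum_of_subset_of_nonneg (fun z hz => ?_) fun _ _ _ => abs_nonneg _
  rw [Finset.mem_filter, Set.Finite.mem_toFinset] at hz
  exact (hfin R).mem_toFinset.2 ⟨hz.2, hz.1.2⟩

lemma isBigO_one_of_forall_abs_le {f : ℝ → ℝ} {C : ℝ} (h : ∀ E : ℝ, 0 ≤ E → |f E| ≤ C) :
    f =O[atTop] fun _ => (1 : ℝ) := by
  refine IsBigO.of_bound C ?_
  filter_upwards [eventually_ge_atTop 0] with E hE
  simpa using h E hE

end Multiplicity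

end EllipticSystem

theorem theorem11 {n m : ℕ} (hm : 0 < m)
    -- the partition `α = p 0 < p 1 < ⋯ < p m = β`
    (α β : ℝ) (p : Fin (m + 1) → ℝ) (hp : StrictMono p) (hα : p 0 = α) (hβ : p (Fin.last m) = β)
    -- the piecewise constant coefficient, with value `M s` on the `s`-th interval
    (A : ℝ → Matrix (Fin n) (Fin n) ℂ) (M : Fin m → Matrix (Fin n) (Fin n) ℂ)
    (hA : ∀ s : Fin m, ∀ x ∈ Set.Ioc (p s.castSucc) (p s.succ), A x = M s)
    -- each `M s` is invertible and diagonalizable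
    (V : Fin m → Matrix (Fin n) (Fin n) ℂ) (a : Fin m → Fin n → ℂ)
    (hV : ∀ s, IsUnit (V s)) (ha : ∀ s i, a s i ≠ 0)
    (hM : ∀ s, M s = V s * Matrix.diagonal (a s) * (V s)⁻¹)
    -- the boundary conditions
    (u v : Fin n → ℂ) (hu : u ≠ 0) (hv : v ≠ 0)
    (hgen : EllipticSystem.Generic p a V u v) :
    -- the eigenvalues of `L`
    (∀ E : ℝ, {z : ℂ | ‖z‖ ≤ E ∧ EllipticSystem.IsEigenvalue α β A u v z}.Finite) ∧
    ((fun E : ℝ => (({z : ℂ | ‖z‖ ≤ E ∧ EllipticSystem.IsEigenvalue α β A u v z}.ncard : ℕ) : ℝ) -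
        E / (2 * Real.pi) * ∫ x in α..β, EllipticSystem.b A x) =O[atTop] fun _ => (1 : ℝ)) ∧
    -- the zeros of the characteristic function, with multiplicity
    (∀ E : ℝ, {z : ℂ | ‖z‖ ≤ E ∧ EllipticSystem.charFun p M u v z = 0}.Finite) ∧
    ((fun E : ℝ => (EllipticSystem.zeroCount (EllipticSystem.charFun p M u v) E : ℝ) -
        E / (2 * Real.pi) * ∫ x in α..β, EllipticSystem.b A x) =O[atTop] fun _ => (1 : ℝ)) := by
  open EllipticSystem in
  have hn : 0 < n := by
    obtain ⟨i, -⟩ := Function.ne_iff.1 hu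
    exact i.pos
  subst hα hβ
  have hS : ((Finset.univ.image (gam p a) : Finset ℂ) : Set ℂ) = Set.range (gam p a) := by simp
  have : Nonempty (Fin n) := ⟨⟨0, hn⟩⟩
  obtain ⟨⟨R, hR⟩, hfin, C, hC⟩ := hgen.genericSum.ncard_zeros
    (Finset.univ_nonempty.image (gam p a))
  have hdiff := differentiable_expSum (Finset.univ.image (gam p a)) (delta p a V u v)
  rw [hS, ← integral_b hn hp hA hV ha hM] at hC
  rw [← charFun_eq_expSum (p := p) (u := u) (v := v) hV ha hM] at hR hfin hC hdiff
  obtain ⟨C', hC'⟩ := zeroCount_sub_ncard_le hdiff hR hfin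
  simp only [isEigenvalue_iff hp (fun s => isUnit_of_conj_diagonal (hV s) (ha s) (hM s)) hA hu]
  refine ⟨hfin, isBigO_one_of_forall_abs_le hC, hfin,
    isBigO_one_of_forall_abs_le (C := C' + C) fun E hE => ?_⟩
  refine (abs_sub_le _ ({z | ‖z‖ ≤ E ∧ charFun p M u v z = 0}.ncard : ℝ) _).trans ?_
  exact add_le_add (hC' E) (hC E hE)
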